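/- Let $\Gamma$ be a torsionless grading monoid (a commutative, cancellative additive monoid whose quotient group $\langle\Gamma\rangle=\{a-b\mid a,b\in\Gamma\}$ is torsion-free), let $R=\bigoplus_{\alpha\in\Gamma}R_\alpha$ be a $\Gamma$-graded integral domain with quotient field $K$, let $H$ be the set of nonzero homogeneous elements of $R$, and let $R_H=\bigoplus_{\alpha\in\langle\Gamma\rangle}(R_H)_\alpha\subseteq K$ be the localization of $R$ at $H$ with its natural grading. A semistar operation on an integral domain $D$ with quotient field $K$ is a map $E\mapsto E^\star$ from the set of nonzero $D$-submodules of $K$ to itself such that, for all $0\neq x\in K$ and all $E,F$: $(xE)^\star=xE^\star$; $E\subseteq F$ implies $E^\star\subseteq F^\star$; $E\subseteq E^\star$ and $(E^\star)^\star=E^\star$. Put $E^{\star_f}=\bigcup\{F^\star\mid 0\neq F\subseteq E,\ F \text{ finitely generated}\}$ and $E^{-1}=\{x\in K\mid xE\subseteq D\}$. Let $d$ be the identity operation, $E^v=(E^{-1})^{-1}$, and $t=v_f$. A nonzero finitely generated $D$-submodule $E$ of $K$ is $\star_f$-invertible if $(EE^{-1})^{\star_f}=D^\star$. The domain $D$ is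 a P$v$MD if every nonzero finitely generated $D$-submodule of $K$ is $t$-invertible (that is, $v_f$-invertible). A graded domain $D$ is a graded P$\star$MD if every nonzero finitely generated homogeneous ideal of $D$ is $\star_f$-invertible; it is a graded Prüfer domain if it is a graded P$d$MD. A homogeneous overring of $R$ is a ring $T$ with $R\subseteq T\subseteq R_H$ and $T=\bigoplus_{\alpha\in\langle\Gamma\rangle}(T\cap (R_H)_\alpha)$; it is graded by $T_\alpha=T\cap(R_H)_\alpha$. Given semistar operations $\star$ on $R$ and $\star'$ on $T$, a homogeneous overring $T$ is called homogeneously $(\star,\star')$-linked if, for every nonzero finitely generated homogeneous ideal $F$ of $R$, $F^\star=R^\star$ implies $(FT)^{\star'}=T^{\star'}$. **Theorem.** Suppose that $R$ has a unit of nonzero degree, and let $\star$ be a semistar operation on $R$ with $R^\star\subsetneq R_H$. Then the following statements are equivalent: 1. $R$ is a graded P$\star$MD. 2. Each homogeneously $(\star,t)$-linked overring of $R$ is a P$v$MD. 3. Each homogeneously $(\star,d)$-linked overring of $R$ is a graded Prüfer domain. 4. Each homogeneously $(\star,t)$-linked overring of $R$ is integrally closed. 5. Each homogeneously $(\star,d)$-linked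 overring of $R$ is integrally closed. -/

import Mathlib

open scoped Pointwise

/-- A semistar operation on an integral domain `D` with quotient field `K`: a self-map `E ↦ E^⋆` of
the set of nonzero `D`-submodules of `K` with the usual three axioms. The map is extended to the
zero submodule by `0^⋆ = 0`, so that it is a total function (a nonzero `E` is sent to a
nonzero submodule because `E ⊆ E^⋆`). -/
structure SemistarOperation (D K : Type*) [CommRing D] [Field K] [Algebra D K] where
  toFun : Submodule D K → Submodule D K
  map_bot : toFun ⊥ = ⊥
  map_smul : ∀ (x : K), x ≠ 0 → ∀ E : Submodule D K, E ≠ ⊥ → toFun (x • E) = x • toFun E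
  mono : ∀ E F : Submodule D K, E ≠ ⊥ → E ≤ F → toFun E ≤ toFun F
  le_apply : ∀ E : Submodule D K, E ≠ ⊥ → E ≤ toFun E
  idem : ∀ E : Submodule D K, E ≠ ⊥ → toFun (toFun E) = toFun E

namespace SemistarOperation

section

variable {D K : Type*} [CommRing D] [Field K] [Algebra D K]

instance : CoeFun (SemistarOperation D K) (fun _ => Submodule D K → Submodule D K) := ⟨toFun⟩

theorem monotone (s : SemistarOperation D K) {E F : Submodule D K} (h : E ≤ F) : s E ≤ s F := by
  by_cases hE : E = ⊥
  · subst hE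
    rw [s.map_bot]
    exact bot_le
  · exact s.mono E F hE h

theorem le_self (s : SemistarOperation D K) (E : Submodule D K) : E ≤ s E := by
  by_cases hE : E = ⊥
  · subst hE
    exact bot_le
  · exact s.le_apply E hE

theorem apply_apply (s : SemistarOperation D K) (E : Submodule D K) : s (s E) = s E := by
  by_cases hE : E = ⊥
  · subst hE
    rw [s.map_bot, s.map_bot]
  · exact s.idem E hE

theorem apply_smul (s : SemistarOperation D K) {x : K} (hx : x ≠ 0) (E : Submodule D K) :
    s (x • E) = x • s E := by
  by_cases hE : E = ⊥
  · subst hE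
    rw [s.map_bot, Submodule.smul_bot', s.map_bot]
  · exact s.map_smul x hx E hE

theorem exists_fg_le (s : SemistarOperation D K) {E G : Submodule D K}
    (h : ∀ x ∈ G, ∃ F : Submodule D K, F.FG ∧ F ≤ E ∧ x ∈ s F) (hG : G.FG) :
    ∃ F : Submodule D K, F.FG ∧ F ≤ E ∧ G ≤ s F := by
  obtain ⟨S, rfl⟩ := hG
  choose! φ hφ using fun x (hx : x ∈ S) => h x (Submodule.subset_span hx)
  refine ⟨⨆ x ∈ S, φ x, Submodule.fg_biSup S _ fun x hx => (hφ x hx).1,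
    iSup₂_le fun x hx => (hφ x hx).2.1, Submodule.span_le.2 fun x hx => ?_⟩
  exact s.monotone (le_iSup₂_of_le x hx le_rfl) (hφ x hx).2.2

/-- The semistar operation of finite type `⋆_f` associated to `⋆`: `E^{⋆_f}` is the union of the
`F^⋆` over the finitely generated `F ⊆ E`. (Allowing `F = 0` adds only the element `0`.) -/
def finiteType (s : SemistarOperation D K) : SemistarOperation D K where
  toFun E :=
    { carrier := {x | ∃ F : Submodule D K, F.FG ∧ F ≤ E ∧ x ∈ s F}
      zero_mem' := ⟨⊥, Submodule.fg_bot, bot_le, Submodule.zero_mem _⟩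
      add_mem' := by
        rintro a b ⟨F, hF, hFE, ha⟩ ⟨G, hG, hGE, hb⟩
        exact ⟨F ⊔ G, hF.sup hG, sup_le hFE hGE,
          Submodule.add_mem _ (s.monotone le_sup_left ha) (s.monotone le_sup_right hb)⟩
      smul_mem' := by
        rintro c a ⟨F, hF, hFE, ha⟩
        exact ⟨F, hF, hFE, Submodule.smul_mem _ c ha⟩ }
  map_bot := by
    refine le_antisymm ?_ bot_le
    rintro x ⟨F, -, hF, hx⟩
    rwa [le_bot_iff.1 hF, s.map_bot] at hx
  map_smul x hx E _ := by
    have key : ∀ (y : K), y ≠ 0 → ∀ (F : Submodule D K), F.FG → (y • F).FG := fun y _ F hF =>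
      hF.map (DistribSMul.toLinearMap D K y)
    ext z
    constructor
    · rintro ⟨F, hF, hFE, hz⟩
      refine ⟨x⁻¹ * z, ⟨x⁻¹ • F, key _ (inv_ne_zero hx) F hF, ?_, ?_⟩, ?_⟩
      · rintro _ ⟨w, hw, rfl⟩
        obtain ⟨e, he, rfl⟩ := hFE hw
        simpa [hx] using he
      · rw [s.apply_smul (inv_ne_zero hx)]
        exact ⟨z, hz, rfl⟩
      · simp [hx]
    · rintro ⟨w, ⟨F, hF, hFE, hw⟩, rfl⟩
      refine ⟨x • F, key x hx F hF, Submodule.map_mono hFE, ?_⟩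
      rw [s.apply_smul hx]
      exact ⟨w, hw, rfl⟩
  mono E F _ h := by
    rintro x ⟨G, hG, hGE, hx⟩
    exact ⟨G, hG, hGE.trans h, hx⟩
  le_apply E _ := by
    intro x hx
    exact ⟨Submodule.span D {x}, Submodule.fg_span_singleton x,
      (Submodule.span_singleton_le_iff_mem x E).2 hx,
      s.le_self _ (Submodule.mem_span_singleton_self x)⟩
  idem E _ := by
    ext x
    constructor
    · rintro ⟨G, hG, hGE, hx⟩
      obtain ⟨F, hF, hFE, hGF⟩ := s.exists_fg_le (E := E) (fun y hy => hGE hy) hG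
      refine ⟨F, hF, hFE, ?_⟩
      rw [← s.apply_apply F]
      exact s.monotone hGF hx
    · rintro ⟨F, hF, hFE, hx⟩
      refine ⟨F, hF, fun y hy => ?_, hx⟩
      exact ⟨F, hF, hFE, s.le_self F hy⟩

end

section

variable (D K : Type*) [CommRing D] [Field K] [Algebra D K]

/-- The identity semistar operation `d`. -/
def d : SemistarOperation D K where
  toFun E := E
  map_bot := rfl
  map_smul _ _ _ _ := rfl
  mono _ _ _ h := h
  le_apply _ _ := le_rfl
  idem _ _ := rfl

variable {D K} in
theorem one_div_smul {x : K} (hx : x ≠ 0) (E : Submodule D K) :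
    (1 : Submodule D K) / (x • E) = x⁻¹ • ((1 : Submodule D K) / E) := by
  ext z
  constructor
  · intro hz
    refine ⟨x * z, fun y hy => ?_, ?_⟩
    · have := hz (x * y) ⟨y, hy, rfl⟩
      rwa [mul_left_comm, ← mul_assoc] at this
    · simp [hx]
  · rintro ⟨w, hw, rfl⟩ _ ⟨y, hy, rfl⟩
    have := hw y hy
    have e : x⁻¹ * w * (x * y) = w * y := by field_simp
    simpa [e] using this

variable {D K} in
theorem le_one_div_one_div (E : Submodule D K) :
    E ≤ (1 : Submodule D K) / ((1 : Submodule D K) / E) := by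
  intro x hx y hy
  rw [mul_comm]
  exact hy x hx

variable {D K} in
theorem one_div_anti {E F : Submodule D K} (h : E ≤ F) :
    (1 : Submodule D K) / F ≤ (1 : Submodule D K) / E :=
  fun _ hx y hy => hx y (h hy)

open Classical in
/-- The `v`-operation `E^v = (E⁻¹)⁻¹` on nonzero `E`, where `E⁻¹ = (D : E) = {x ∈ K | xE ⊆ D}`,
which is `1 / E` in Mathlib's notation (`1` is the submodule `D` of `K`). -/
noncomputable def v : SemistarOperation D K where
  toFun E := if E = ⊥ then ⊥ else 1 / (1 / E)
  map_bot := by simp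
  map_smul x hx E hE := by
    have hxE : x • E ≠ ⊥ := by
      intro h
      apply hE
      rw [← inv_smul_smul₀ hx E, h, Submodule.smul_bot']
    rw [if_neg hE, if_neg hxE, one_div_smul hx, one_div_smul (inv_ne_zero hx), inv_inv]
  mono E F hE h := by
    have hF : F ≠ ⊥ := fun hF => hE (le_bot_iff.1 (hF ▸ h))
    rw [if_neg hE, if_neg hF]
    exact one_div_anti (one_div_anti h)
  le_apply E hE := by
    rw [if_neg hE]
    exact le_one_div_one_div E
  idem E hE := by
    have h : (1 : Submodule D K) / (1 / E) ≠ ⊥ := fun h =>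
      hE (le_bot_iff.1 (h ▸ le_one_div_one_div E))
    rw [if_neg hE, if_neg h]
    exact le_antisymm (one_div_anti (le_one_div_one_div _)) (le_one_div_one_div _)

/-- The `t`-operation `t = v_f`. -/
noncomputable def t : SemistarOperation D K := (v D K).finiteType

end

end SemistarOperation

section Multiplication

variable {D K : Type*} [CommRing D] [Field K] [Algebra D K]

/-- `E` is `⋆_f`-invertible: `(E E⁻¹)^{⋆_f} = D^⋆`. -/
def IsStarInvertible (s : SemistarOperation D K) (E : Submodule D K) : Prop :=
  s.finiteType (E * (1 / E)) = s 1

/-- Prüfer `⋆`-multiplication domain. -/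
def IsPStarMD (s : SemistarOperation D K) : Prop :=
  ∀ E : Submodule D K, E.FG → E ≠ ⊥ → IsStarInvertible s E

variable {ι : Type*}

/-- `I` is a homogeneous ideal, i.e. `I = I_h`, where `I_h` is the ideal generated by the
homogeneous elements of `I`. The family `𝒜` is the family of homogeneous components of `D`. -/
def IsHomogeneousIdeal (𝒜 : ι → AddSubgroup D) (I : Ideal D) : Prop :=
  I.homogeneousCore' 𝒜 = I

/-- Agreement with Mathlib's notion of homogeneous ideal for a graded ring. -/
theorem isHomogeneousIdeal_iff [DecidableEq ι] [AddMonoid ι] (𝒜 : ι → AddSubgroup D)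
    [GradedRing 𝒜] (I : Ideal D) : IsHomogeneousIdeal 𝒜 I ↔ I.IsHomogeneous 𝒜 :=
  (Ideal.IsHomogeneous.iff_eq 𝒜 I).symm

/-- Graded Prüfer `⋆`-multiplication domain: every nonzero finitely generated homogeneous ideal is
`⋆_f`-invertible. -/
def IsGradedPStarMD (𝒜 : ι → AddSubgroup D) (s : SemistarOperation D K) : Prop :=
  ∀ I : Ideal D, I.FG → I ≠ ⊥ → IsHomogeneousIdeal 𝒜 I →
    IsStarInvertible s (IsLocalization.coeSubmodule K I)

end Multiplication

/-- `D` (with quotient field `K`) is a Prüfer `v`-multiplication domain. -/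
def IsPvMD (D K : Type*) [CommRing D] [Field K] [Algebra D K] : Prop :=
  IsPStarMD (SemistarOperation.v D K)

/-- Graded Prüfer domain. -/
def IsGradedPrufer {D ι : Type*} (K : Type*) [CommRing D] [Field K] [Algebra D K]
    (𝒜 : ι → AddSubgroup D) : Prop :=
  IsGradedPStarMD 𝒜 (SemistarOperation.d D K)

section Overrings

variable {Γ R : Type*} [AddCommMonoid Γ] [CommRing R] (𝒜 : Γ → AddSubgroup R)

/-- The multiplicative set `H` of nonzero homogeneous elements of the graded domain `R`. -/
def nonzeroHomogeneous [SetLike.GradedMonoid 𝒜] : Submonoid R :=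
  SetLike.homogeneousSubmonoid 𝒜 ⊓ nonZeroDivisors R

variable [IsDomain R] (K : Type*) [Field K] [Algebra R K] [IsFractionRing R K]

/-- The homogeneous quotient field `R_H`, as a subalgebra of the quotient field `K`. -/
noncomputable def homogeneousQuotientField [SetLike.GradedMonoid 𝒜] : Subalgebra R K :=
  Localization.subalgebra.ofField K (nonzeroHomogeneous 𝒜) inf_le_right

/-- The homogeneous component `(R_H)_γ`, for `γ` in the quotient group `⟨Γ⟩` of `Γ`: zero and the
fractions `a / b` with `a ∈ R_α`, `0 ≠ b ∈ R_β` and `γ = α - β`. -/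
def homogeneousQuotientFieldComponent [IsCancelAdd Γ] [SetLike.GradedMonoid 𝒜]
    (γ : Algebra.GrothendieckAddGroup Γ) : AddSubgroup K where
  carrier := {x | x = 0 ∨ ∃ α β : Γ, ∃ a ∈ 𝒜 α, ∃ b ∈ 𝒜 β, b ≠ 0 ∧
    γ = Algebra.GrothendieckAddGroup.of α - Algebra.GrothendieckAddGroup.of β ∧
    x = algebraMap R K a / algebraMap R K b}
  zero_mem' := Or.inl rfl
  add_mem' := by
    rintro _ _ (rfl | ⟨α, β, a, ha, b, hb, hb0, hγ, rfl⟩) h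
    · simpa using h
    rcases h with rfl | ⟨α', β', a', ha', b', hb', hb0', hγ', rfl⟩
    · exact Or.inr ⟨α, β, a, ha, b, hb, hb0, hγ, by simp⟩
    have hdeg : α' + β = α + β' := by
      have h : Algebra.GrothendieckAddGroup.of (α' + β) =
          Algebra.GrothendieckAddGroup.of (α + β') := by
        have := hγ.symm.trans hγ'
        rw [sub_eq_sub_iff_add_eq_add] at this
        rw [map_add, map_add, this]
      obtain ⟨c, hc⟩ := (AddLocalization.addMonoidOf (⊤ : AddSubmonoid Γ)).eq_iff_exists.1 h
      exact add_left_cancel hc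
    have hK : ∀ {r : R}, r ≠ 0 → algebraMap R K r ≠ 0 := fun h =>
      (map_ne_zero_iff _ (IsFractionRing.injective R K)).2 h
    refine Or.inr ⟨α + β', β + β', a * b' + a' * b,
      add_mem (SetLike.mul_mem_graded ha hb') (hdeg ▸ SetLike.mul_mem_graded ha' hb),
      b * b', SetLike.mul_mem_graded hb hb', mul_ne_zero hb0 hb0', ?_, ?_⟩
    · rw [hγ, map_add, map_add]
      abel
    · have h1 := hK hb0
      have h2 := hK hb0'
      simp only [map_add, map_mul]
      field_simp
  neg_mem' := by
    rintro _ (rfl | ⟨α, β, a, ha, b, hb, hb0, hγ, rfl⟩)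
    · exact Or.inl neg_zero
    · exact Or.inr ⟨α, β, -a, neg_mem ha, b, hb, hb0, hγ, by simp [neg_div]⟩

variable {K} [IsCancelAdd Γ] [SetLike.GradedMonoid 𝒜]

/-- `T` is a homogeneous overring of `R`: `R ⊆ T ⊆ R_H` and every element of `T` is a sum of
elements of the groups `T ∩ (R_H)_γ` (the sum of these is direct since the sum of the `(R_H)_γ` is
direct). -/
structure IsHomogeneousOverring (T : Subalgebra R K) : Prop where
  le : T ≤ homogeneousQuotientField 𝒜 K
  eq_iSup : T.toSubring.toAddSubgroup =
    ⨆ γ, T.toSubring.toAddSubgroup ⊓ homogeneousQuotientFieldComponent 𝒜 K γ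

/-- The grading `T_γ = T ∩ (R_H)_γ` of a homogeneous overring `T`, as subgroups of `T`. -/
def overringComponent (T : Subalgebra R K) (γ : Algebra.GrothendieckAddGroup Γ) : AddSubgroup T :=
  (homogeneousQuotientFieldComponent 𝒜 K γ).comap (algebraMap T K).toAddMonoidHom

/-- `T` is a homogeneously `(⋆, ⋆')`-linked overring of `R`. -/
structure IsHomogeneouslyLinked (s : SemistarOperation R K) (T : Subalgebra R K)
    (s' : SemistarOperation T K) : Prop where
  isHomogeneousOverring : IsHomogeneousOverring 𝒜 T
  linked : ∀ F : Ideal R, F ≠ ⊥ → F.FG → IsHomogeneousIdeal 𝒜 F →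
    s (IsLocalization.coeSubmodule K F) = s 1 →
      s' (IsLocalization.coeSubmodule K (F.map (algebraMap R T))) = s' 1

end Overrings

/-!
Everything is expressed by homogeneous submodules of the quotient field `K`: `R` is a graded P`⋆`MD
exactly when every finite set of homogeneous elements of `K` spans a `⋆_f`-invertible `R`-module,
and this property passes to `(⋆, ⋆')`-linked overrings.

A graded domain whose finitely generated homogeneous modules are `t`-invertible is a P`v`MD. By the
trick `(A + B)(B + C)(C + A) = (A + B + C)(AB + BC + CA)` it suffices to invert the modules
`(p, q)`. Over the graded field of fractions, which locally is a Laurent polynomial ring and so has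
factorization, one divides by a common factor to make `p`, `q` coprime. Then `(D : (p, q))` is
contained in the graded field, and by Gauss' lemma it is the inverse of the ideal generated by the
homogeneous components of `p` and `q`, which is `t`-invertible.

Conversely, if `(EE⁻¹)^{⋆_f} ≠ R^⋆` for a homogeneous `E`, then `EE⁻¹` is contained in a prime `Q`
with `1 ∉ Q^{⋆_f}`, and every homogeneous overring that contains the homogeneous localization at `Q`
is `(⋆, d)`-linked. If these overrings are integrally closed then so is `R_Q`, and for homogeneous
`x` the overring generated by `x²` contains `x`. The resulting relation has a coefficient `-1`, so
that `x ∈ R_Q` or `x⁻¹ ∈ R_Q`. Hence `E` is principal at `Q`, which contradicts `EE⁻¹ ⊆ Q`.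
-/

section

variable {D K : Type*} [CommRing D] [Field K] [Algebra D K]

theorem fg_one_submodule : (1 : Submodule D K).FG := by
  rw [Submodule.one_eq_span]
  exact Submodule.fg_span_singleton 1

theorem mem_one_div_span {S : Set K} {x : K} :
    x ∈ (1 : Submodule D K) / Submodule.span D S ↔ ∀ y ∈ S, x * y ∈ (1 : Submodule D K) := by
  rw [← Submodule.span_singleton_le_iff_mem, Submodule.le_div_iff_mul_le, Submodule.span_mul_span,
    Submodule.span_le, Set.singleton_mul, Set.image_subset_iff]
  rfl

end

namespace SemistarOperation

variable {D K : Type*} [CommRing D] [Field K] [Algebra D K] {s s' : SemistarOperation D K}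
  {E F W : Submodule D K}

theorem finiteType_le_apply (s : SemistarOperation D K) (E : Submodule D K) :
    s.finiteType E ≤ s E := by
  rintro x ⟨F, -, hFE, hx⟩
  exact s.monotone hFE hx

theorem finiteType_apply_of_fg (hE : E.FG) : s.finiteType E = s E :=
  le_antisymm (s.finiteType_le_apply E) fun _ hx => ⟨E, hE, le_rfl, hx⟩

theorem finiteType_mono (h : ∀ E, s E ≤ s' E) (E : Submodule D K) :
    s.finiteType E ≤ s'.finiteType E := by
  rintro x ⟨F, hF, hFE, hx⟩
  exact ⟨F, hF, hFE, h F hx⟩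

theorem exists_mem_finiteType_of_mem_sSup (s : SemistarOperation D K) {c : Set (Submodule D K)}
    (hne : c.Nonempty) (hdir : DirectedOn (· ≤ ·) c) {x : K} (hx : x ∈ s.finiteType (sSup c)) :
    ∃ M ∈ c, x ∈ s.finiteType M := by
  obtain ⟨F, hF, hFc, hxF⟩ := hx
  obtain ⟨M, hM, hFM⟩ := (CompleteLattice.isCompactElement_iff_le_of_directed_sSup_le _ F).1
    ((Submodule.fg_iff_compact F).1 hF) c hne hdir hFc
  exact ⟨M, hM, F, hF, hFM, hxF⟩

theorem apply_mul_le (s : SemistarOperation D K) (E F : Submodule D K) :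
    s E * F ≤ s (E * F) := by
  refine Submodule.mul_le.2 fun x hx y hy => ?_
  rcases eq_or_ne y 0 with rfl | hy0
  · simp
  have hyE : y • E ≤ E * F := by
    rintro _ ⟨e, he, rfl⟩
    rw [mul_comm]
    exact Submodule.mul_mem_mul hy he
  refine s.monotone hyE ?_
  rw [s.apply_smul hy0]
  exact ⟨x, hx, mul_comm y x⟩

theorem apply_mul_apply_le (s : SemistarOperation D K) (E F : Submodule D K) :
    s E * s F ≤ s (E * F) :=
  calc s E * s F ≤ s (E * s F) := s.apply_mul_le E (s F)
    _ ≤ s (s (E * F)) := s.monotone (by simpa only [mul_comm] using s.apply_mul_le F E)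
    _ = s (E * F) := s.apply_apply _

theorem le_apply_of_mul_le (hW : 1 ∈ s W) (h : E * W ≤ F) : E ≤ s F := by
  intro x hx
  have : 1 * x ∈ s W * E := Submodule.mul_mem_mul hW hx
  rw [one_mul] at this
  exact s.monotone (mul_comm E W ▸ h) (s.apply_mul_le W E this)

theorem apply_one_le_iff : s 1 ≤ s E ↔ 1 ∈ s E := by
  refine ⟨fun h => h (s.le_self 1 (Submodule.one_le.1 le_rfl)), fun h => ?_⟩
  rw [← s.apply_apply E]
  exact s.monotone (Submodule.one_le.2 h)

theorem apply_eq_apply_one_iff (hE : E ≤ 1) : s E = s 1 ↔ 1 ∈ s E := by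
  rw [← apply_one_le_iff, le_antisymm_iff, and_iff_right (s.monotone hE)]

theorem v_apply (hE : E ≠ ⊥) : v D K E = 1 / (1 / E) := if_neg hE

theorem v_one : v D K 1 = 1 := by
  have one_div_one : (1 : Submodule D K) / 1 = 1 :=
    le_antisymm (by simpa using (Submodule.mul_one_div_le_one : (1 : Submodule D K) * (1 / 1) ≤ 1))
      (Submodule.one_le_one_div.2 le_rfl)
  rw [v_apply one_ne_zero, one_div_one, one_div_one]

theorem t_one : t D K 1 = 1 := by
  rw [t, finiteType_apply_of_fg fg_one_submodule, v_one]

end SemistarOperation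

namespace IsStarInvertible

open SemistarOperation

variable {D K : Type*} [CommRing D] [Field K] [Algebra D K] {s s' : SemistarOperation D K}
  {E F : Submodule D K}

theorem _root_.isStarInvertible_iff : IsStarInvertible s E ↔ 1 ∈ s.finiteType (E * (1 / E)) := by
  rw [IsStarInvertible, ← finiteType_apply_of_fg (s := s) fg_one_submodule,
    apply_eq_apply_one_iff Submodule.mul_one_div_le_one]

theorem mono (h : ∀ E, s E ≤ s' E) (hE : IsStarInvertible s E) : IsStarInvertible s' E :=
  isStarInvertible_iff.2 (finiteType_mono h _ (isStarInvertible_iff.1 hE))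

theorem of_mul (h : IsStarInvertible s (E * F)) : IsStarInvertible s E := by
  rw [isStarInvertible_iff] at h ⊢
  refine s.finiteType.monotone ?_ h
  rw [mul_assoc]
  gcongr
  rw [Submodule.le_div_iff_mul_le, mul_comm, ← mul_assoc]
  exact Submodule.mul_one_div_le_one

theorem mul (hE : IsStarInvertible s E) (hF : IsStarInvertible s F) :
    IsStarInvertible s (E * F) := by
  rw [isStarInvertible_iff] at hE hF ⊢
  have hinv : 1 / E * (1 / F) ≤ 1 / (E * F) := by
    rw [Submodule.le_div_iff_mul_le, mul_mul_mul_comm, mul_comm _ E, mul_comm _ F]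
    simpa using mul_le_mul' (Submodule.mul_one_div_le_one (I := E))
      (Submodule.mul_one_div_le_one (I := F))
  have hprod := s.finiteType.apply_mul_apply_le _ _ (Submodule.mul_mem_mul hE hF)
  rw [mul_one, mul_mul_mul_comm] at hprod
  exact s.finiteType.monotone (mul_le_mul_right hinv _) hprod

theorem span_singleton (s : SemistarOperation D K) {x : K} (hx : x ≠ 0) :
    IsStarInvertible s (Submodule.span D {x}) := by
  rw [isStarInvertible_iff]
  refine s.finiteType.le_self _ ?_
  rw [← mul_inv_cancel₀ hx]
  exact Submodule.mul_mem_mul (Submodule.mem_span_singleton_self x)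
    (mem_one_div_span.2 (by simpa [hx] using ⟨1, map_one _⟩))

theorem sup_sup {A B C : Submodule D K} (hAB : IsStarInvertible s (A ⊔ B))
    (hBC : IsStarInvertible s (B ⊔ C)) (hCA : IsStarInvertible s (C ⊔ A)) :
    IsStarInvertible s (A ⊔ B ⊔ C) := by
  have key : (A ⊔ B) * (B ⊔ C) * (C ⊔ A) = (A ⊔ B ⊔ C) * (A * B ⊔ B * C ⊔ C * A) := by
    have hABC : A * B * C + A * B * C = A * B * C := by rw [Submodule.add_eq_sup, sup_idem]
    simp only [← Submodule.add_eq_sup]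
    calc (A + B) * (B + C) * (C + A)
        = A * A * B + A * A * C + A * B * B + B * B * C + B * C * C + A * C * C
          + (A * B * C + A * B * C) := by ring
      _ = A * A * B + A * A * C + A * B * B + B * B * C + B * C * C + A * C * C
          + (A * B * C + A * B * C + A * B * C) := by rw [hABC, hABC]
      _ = (A + B + C) * (A * B + B * C + C * A) := by ring
  exact of_mul (key ▸ (hAB.mul hBC).mul hCA)

theorem span_insert_of_pair
    (hpair : ∀ x y : K, x ≠ 0 → y ≠ 0 → IsStarInvertible s (Submodule.span D {x, y}))
    (S : Finset K) {a : K} (ha : a ≠ 0) :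
    IsStarInvertible s (Submodule.span D (insert a (S : Set K))) := by
  classical
  induction S using Finset.induction_on generalizing a with
  | empty => simpa using span_singleton s ha
  | insert c S _ ih =>
    rcases eq_or_ne c 0 with rfl | hc
    · rw [Finset.coe_insert, Set.insert_comm, Submodule.span_insert_zero]
      exact ih ha
    · have hcS := ih hc
      have haS := ih ha
      have hac := hpair a c ha hc
      rw [Submodule.span_insert] at hcS haS hac
      rw [Finset.coe_insert, Submodule.span_insert, Submodule.span_insert, ← sup_assoc]
      exact sup_sup hac hcS (sup_comm (Submodule.span D {a}) _ ▸ haS)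

theorem _root_.isPStarMD_of_pair
    (hpair : ∀ x y : K, x ≠ 0 → y ≠ 0 → IsStarInvertible s (Submodule.span D {x, y})) :
    IsPStarMD s := by
  rintro _ ⟨S, rfl⟩ hS
  obtain ⟨a, haS, ha⟩ := Submodule.exists_mem_ne_zero_of_ne_bot hS
  rw [← Submodule.span_insert_eq_span haS]
  exact span_insert_of_pair hpair S ha

theorem le_one_of_mul_le (hE : IsStarInvertible (v D K) E) (h : F * E ≤ E) : F ≤ 1 := by
  rw [isStarInvertible_iff] at hE
  rw [← t_one]
  refine le_apply_of_mul_le hE ?_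
  rw [← mul_assoc]
  exact (mul_le_mul_left h _).trans Submodule.mul_one_div_le_one

theorem _root_.IsPvMD.isIntegrallyClosed [IsFractionRing D K] (h : IsPvMD D K) :
    IsIntegrallyClosed D := by
  rw [isIntegrallyClosed_iff K]
  intro x hx
  let A := Subalgebra.toSubmodule (Algebra.adjoin D {x})
  have hA : A * A ≤ A := (Subalgebra.mul_toSubmodule_le _ _).trans (by rw [sup_idem])
  have hA0 : A ≠ ⊥ := fun hbot => one_ne_zero <| (Submodule.mem_bot D).1 <| hbot.le <|
    one_mem (Algebra.adjoin D {x})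
  have hA_inv : IsStarInvertible (v D K) A := h A hx.fg_adjoin_singleton hA0
  have hxA : x ∈ A := Algebra.self_mem_adjoin_singleton D x
  simpa using hA_inv.le_one_of_mul_le hA hxA

theorem of_le_apply (hE : E.FG) (hEF : E ≤ F) (hFE : F ≤ s E) (hF : IsStarInvertible s F) :
    IsStarInvertible s E := by
  rw [isStarInvertible_iff] at hF ⊢
  rw [← finiteType_apply_of_fg hE] at hFE
  rw [← apply_apply]
  refine s.finiteType.monotone ?_ hF
  calc F * (1 / F) ≤ s.finiteType E * (1 / E) := mul_le_mul' hFE (one_div_anti hEF)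
    _ ≤ s.finiteType (E * (1 / E)) := s.finiteType.apply_mul_le _ _

end IsStarInvertible

theorem SemistarOperation.le_v_of_one_div_le {D K : Type*} [CommRing D] [Field K] [Algebra D K]
    {E F : Submodule D K} (hE : E ≠ ⊥) (h : 1 / E ≤ 1 / F) : F ≤ v D K E := by
  rw [v_apply hE]
  exact (le_one_div_one_div F).trans (one_div_anti h)

theorem exists_prime_of_one_notMem_finiteType {D K : Type*} [CommRing D] [Field K] [Algebra D K]
    {s : SemistarOperation D K} {I : Ideal D}
    (hI : 1 ∉ s.finiteType (IsLocalization.coeSubmodule K I)) :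
    ∃ Q : Ideal D, Q.IsPrime ∧ I ≤ Q ∧ 1 ∉ s.finiteType (IsLocalization.coeSubmodule K Q) := by
  have hOka : Ideal.IsOka fun J : Ideal D => 1 ∈ s.finiteType (IsLocalization.coeSubmodule K J) :=
    { top := s.finiteType.le_self _ ⟨1, trivial, map_one (algebraMap D K)⟩
      oka := fun {J a} hsup hcolon => by
        have hle : IsLocalization.coeSubmodule K (J ⊔ Ideal.span {a})
            * IsLocalization.coeSubmodule K (J.colon (Ideal.span {a}))
            ≤ IsLocalization.coeSubmodule K J := by
          rw [← IsLocalization.coeSubmodule_mul]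
          refine IsLocalization.coeSubmodule_mono K ?_
          rw [Ideal.sup_mul, Ideal.colon_span]
          refine sup_le Ideal.mul_le_left (Ideal.span_singleton_mul_le_iff.2 fun b hb => ?_)
          simpa only [mul_comm a, smul_eq_mul] using Submodule.mem_colon_singleton.1 hb
        have := s.finiteType.apply_mul_apply_le _ _ (Submodule.mul_mem_mul hsup hcolon)
        rw [mul_one] at this
        exact s.finiteType.monotone hle this }
  have hchain : ∀ c ⊆ {J : Ideal D | 1 ∉ s.finiteType (IsLocalization.coeSubmodule K J)},
      IsChain (· ≤ ·) c → ∀ J ∈ c, ∃ ub ∈ {J : Ideal D |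
        1 ∉ s.finiteType (IsLocalization.coeSubmodule K J)}, ∀ M ∈ c, M ≤ ub := by
    intro c hc hchain J hJ
    refine ⟨sSup c, fun h1 => ?_, fun _ => le_sSup⟩
    have hdir : DirectedOn (· ≤ ·) (IsLocalization.coeSubmodule K '' c) :=
      directedOn_image.2 (hchain.directedOn.mono' fun _ _ _ _ h =>
        IsLocalization.coeSubmodule_mono K h)
    rw [IsLocalization.coeSubmodule, (Submodule.gc_map_comap _).l_sSup, ← sSup_image] at h1
    obtain ⟨_, ⟨M, hM, rfl⟩, hM1⟩ :=
      s.exists_mem_finiteType_of_mem_sSup (Set.Nonempty.image _ ⟨J, hJ⟩) hdir h1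
    exact hc hM hM1
  obtain ⟨Q, hIQ, hQ⟩ := zorn_le_nonempty₀ _ hchain I hI
  exact ⟨Q, hOka.isPrime_of_maximal_not hQ, hIQ, hQ.prop⟩

theorem twoUniqueSums_of_isAddTorsionFree (G : Type*) [AddCommGroup G] [IsAddTorsionFree G] :
    TwoUniqueSums G :=
  .of_injective_addHom (DivisibleHull.coeAddMonoidHom (M := G)).toAddHom
    DivisibleHull.coe_injective inferInstance

section Content

open AddMonoidAlgebra

theorem exists_coeff_mul_notMem {D G : Type*} [CommRing D] [AddMonoid G] [UniqueSums G]
    {Q : Ideal D} [Q.IsPrime] {p q : AddMonoidAlgebra D G} (hp : ∃ γ, p.coeff γ ∉ Q)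
    (hq : ∃ γ, q.coeff γ ∉ Q) : ∃ γ, (p * q).coeff γ ∉ Q := by
  have map_mk_ne_zero {r : AddMonoidAlgebra D G} :
      mapRingHom G (Ideal.Quotient.mk Q) r ≠ 0 ↔ ∃ γ, r.coeff γ ∉ Q := by
    simp [AddMonoidAlgebra.ext_iff, Finsupp.ext_iff, Ideal.Quotient.eq_zero_iff_mem]
  rw [← map_mk_ne_zero] at hp hq ⊢
  rw [map_mul]
  exact mul_ne_zero hp hq

variable {D K G : Type*} [CommRing D] [Field K] [Algebra D K]

variable (D) in
/-- The content of an element of a group algebra over `K`: the `D`-submodule of `K` spanned by its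
coefficients. -/
def content (p : AddMonoidAlgebra K G) : Submodule D K :=
  Submodule.span D (Set.range p.coeff)

theorem content_le_iff {p : AddMonoidAlgebra K G} {E : Submodule D K} :
    content D p ≤ E ↔ ∀ γ, p.coeff γ ∈ E := by
  rw [content, Submodule.span_le, Set.range_subset_iff]
  rfl

theorem coeff_mem_content (p : AddMonoidAlgebra K G) (γ : G) : p.coeff γ ∈ content D p :=
  content_le_iff.1 le_rfl γ

theorem mem_one_div_content {p : AddMonoidAlgebra K G} {x : K} :
    x ∈ 1 / content D p ↔ ∀ γ, x * p.coeff γ ∈ (1 : Submodule D K) := by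
  rw [content, mem_one_div_span, Set.forall_mem_range]

theorem content_mul_le [AddMonoid G] (p q : AddMonoidAlgebra K G) :
    content D (p * q) ≤ content D p * content D q := by
  classical
  refine content_le_iff.2 fun γ => ?_
  rw [coeff_mul]
  refine sum_mem fun α _ => sum_mem fun β _ => ?_
  dsimp only
  split_ifs
  · exact Submodule.mul_mem_mul (coeff_mem_content p α) (coeff_mem_content q β)
  · exact zero_mem _

/-- A multiple of `p` with coefficients in `D` is nonzero modulo a prime avoided by the
invertibility of its content. -/
theorem IsStarInvertible.exists_smul_eq_map [AddMonoid G] {s : SemistarOperation D K}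
    {p : AddMonoidAlgebra K G} (hp : IsStarInvertible s (content D p)) {Q : Ideal D}
    (hQ : 1 ∉ s.finiteType (IsLocalization.coeSubmodule K Q)) :
    ∃ u ∈ 1 / content D p, ∃ p' : AddMonoidAlgebra D G,
      mapRingHom G (algebraMap D K) p' = u • p ∧ ∃ γ, p'.coeff γ ∉ Q := by
  by_contra! hcon
  refine hQ (s.finiteType.monotone ?_ (isStarInvertible_iff.1 hp))
  refine Submodule.le_div_iff_mul_le.1 (content_le_iff.2 fun γ u hu => ?_)
  have hcoeff : u • p ∈ Set.range (map (M := G) (algebraMap D K : D →+ K)) := by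
    rw [range_map]
    exact fun γ => Submodule.mem_one.1 (mem_one_div_content.1 hu γ)
  obtain ⟨p', hp'⟩ := hcoeff
  refine ⟨p'.coeff γ, hcon u hu p' hp' γ, ?_⟩
  simpa [mul_comm] using congrArg (fun r => r.coeff γ) hp'

theorem content_mul_content_le_finiteType [FaithfulSMul D K] [AddMonoid G] [UniqueSums G]
    {s : SemistarOperation D K} {p q : AddMonoidAlgebra K G}
    (hp : IsStarInvertible s (content D p)) (hq : IsStarInvertible s (content D q)) :
    content D p * content D q ≤ s.finiteType (content D (p * q)) := by
  set W := content D (p * q) * (1 / content D p * (1 / content D q)) with hW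
  have hW1 : W ≤ 1 :=
    calc W ≤ content D p * content D q * (1 / content D p * (1 / content D q)) :=
          mul_le_mul_left (content_mul_le p q) _
      _ = content D p * (1 / content D p) * (content D q * (1 / content D q)) :=
          mul_mul_mul_comm _ _ _ _
      _ ≤ 1 * 1 := mul_le_mul' Submodule.mul_one_div_le_one Submodule.mul_one_div_le_one
      _ = 1 := one_mul 1
  obtain ⟨I, hI⟩ : ∃ I : Ideal D, IsLocalization.coeSubmodule K I = W :=
    ⟨W.comap (Algebra.linearMap D K), Submodule.map_comap_eq_self (by
      rwa [← Submodule.one_eq_range])⟩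
  have one_mem : 1 ∈ s.finiteType W := by
    by_contra hone
    rw [← hI] at hone
    obtain ⟨Q, hQ, hIQ, hQs⟩ := exists_prime_of_one_notMem_finiteType hone
    obtain ⟨u, hu, p', hp', hpQ⟩ := hp.exists_smul_eq_map hQs
    obtain ⟨w, hw, q', hq', hqQ⟩ := hq.exists_smul_eq_map hQs
    obtain ⟨γ, hγ⟩ := exists_coeff_mul_notMem hpQ hqQ
    refine hγ (hIQ ?_)
    have hmap : algebraMap D K ((p' * q').coeff γ) = (p * q).coeff γ * (u * w) := by
      rw [← coeff_mapRingHom, map_mul, hp', hq', smul_mul_smul_comm]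
      simp [mul_comm]
    have : algebraMap D K ((p' * q').coeff γ) ∈ IsLocalization.coeSubmodule K I := by
      rw [hI, hmap]
      exact Submodule.mul_mem_mul (coeff_mem_content _ γ) (Submodule.mul_mem_mul hu hw)
    obtain ⟨a, ha, haγ⟩ := this
    rwa [← FaithfulSMul.algebraMap_injective D K haγ]
  refine SemistarOperation.le_apply_of_mul_le one_mem ?_
  calc content D p * content D q * W = content D (p * q) *
        (content D p * (1 / content D p) * (content D q * (1 / content D q))) := by
        rw [hW]; ring
    _ ≤ content D (p * q) * (1 * 1) := by
        gcongr <;> exact Submodule.mul_one_div_le_one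
    _ = content D (p * q) := by rw [one_mul, mul_one]

end Content

section GradedSubfield

open AddMonoidAlgebra

theorem exists_linearIndependent_closure_eq {G : Type*} [AddCommGroup G] [IsAddTorsionFree G]
    {S : Set G} (hS : S.Finite) : ∃ (n : ℕ) (e : Fin n → G), LinearIndependent ℤ e ∧
      AddSubgroup.closure (Set.range e) = AddSubgroup.closure S := by
  let N : Submodule ℤ G := Submodule.span ℤ S
  have : Module.Finite ℤ N := .span_of_finite ℤ hS
  let b := Module.finBasis ℤ N
  refine ⟨_, fun i => (b i : G), b.linearIndependent.map' N.subtype N.ker_subtype, ?_⟩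
  have hb : Submodule.span ℤ (Set.range fun i => (b i : G)) = N := by
    rw [Set.range_comp' Subtype.val b, ← N.coe_subtype, Submodule.span_image, b.span_eq,
      Submodule.map_top, N.range_subtype]
  rw [← Submodule.span_int_eq_addSubgroupClosure, hb, Submodule.span_int_eq_addSubgroupClosure]

theorem prod_pow_ne_zero {ι K : Type*} [Field K] {u : ι → K} (hu : ∀ i, u i ≠ 0) (m : ι →₀ ℕ) :
    (m.prod fun i n => u i ^ n) ≠ 0 :=
  Finset.prod_ne_zero_iff.2 fun i _ => pow_ne_zero _ (hu i)

theorem exists_add_linearCombination {G ι : Type*} [AddCommGroup G] {e : ι → G} {γ : G}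
    (hγ : γ ∈ AddSubgroup.closure (Set.range e)) :
    ∃ m n : ι →₀ ℕ, γ + Finsupp.linearCombination ℕ e m = Finsupp.linearCombination ℕ e n := by
  induction hγ using AddSubgroup.closure_induction with
  | mem x hx =>
    obtain ⟨i, rfl⟩ := hx
    exact ⟨0, Finsupp.single i 1, by simp⟩
  | zero => exact ⟨0, 0, by simp⟩
  | add x y _ _ hx hy =>
    obtain ⟨m, n, h⟩ := hx
    obtain ⟨m', n', h'⟩ := hy
    exact ⟨m + m', n + n', by rw [map_add, map_add, ← h, ← h']; abel⟩
  | neg x _ hx =>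
    obtain ⟨m, n, h⟩ := hx
    exact ⟨n, m, by rw [← h]; abel⟩

variable {G K : Type*} [AddCommGroup G] [Field K]

variable (G K) in
/-- The augmentation of a group algebra: the sum of the coefficients. -/
noncomputable def coeffSum : AddMonoidAlgebra K G →ₐ[K] K :=
  AddMonoidAlgebra.lift K K G 1

theorem coeffSum_single (γ : G) (x : K) : coeffSum G K (single γ x) = x := by
  simp [coeffSum]

theorem coeffSum_eq_sum (p : AddMonoidAlgebra K G) :
    coeffSum G K p = ∑ γ ∈ p.coeff.support, p.coeff γ := by
  simp [coeffSum, AddMonoidAlgebra.lift_apply, Finsupp.sum]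

theorem coeffSum_mem {S : Type*} [SetLike S K] [AddSubmonoidClass S K] {E : S}
    {p : AddMonoidAlgebra K G} (h : ∀ γ, p.coeff γ ∈ E) : coeffSum G K p ∈ E := by
  rw [coeffSum_eq_sum]
  exact sum_mem fun γ _ => h γ

/-- The family `C` of subgroups of the field `K` consists of the homogeneous components of a graded
field: its nonzero elements are closed under products and inverses, and its sum is direct.
An element of the sum is represented by the element of the group algebra having the homogeneous
components as coefficients. -/
structure IsGradedSubfield (C : G → AddSubgroup K) : Prop where
  one_mem_zero : (1 : K) ∈ C 0
  mul_mem_add : ∀ {γ δ : G} {x y : K}, x ∈ C γ → y ∈ C δ → x * y ∈ C (γ + δ)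
  inv_mem_neg : ∀ {γ : G} {x : K}, x ∈ C γ → x⁻¹ ∈ C (-γ)
  eq_zero : ∀ p : AddMonoidAlgebra K G, (∀ γ, p.coeff γ ∈ C γ) → coeffSum G K p = 0 → p = 0

namespace IsGradedSubfield

variable {C : G → AddSubgroup K} (hC : IsGradedSubfield C)

/-- The subring of the group algebra that represents the graded field. -/
def ring : Subring (AddMonoidAlgebra K G) where
  carrier := {p | ∀ γ, p.coeff γ ∈ C γ}
  mul_mem' {p q} hp hq γ := by
    rw [coeff_mul_apply_left]
    refine sum_mem fun δ _ => ?_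
    simpa using hC.mul_mem_add (hp δ) (hq (-δ + γ))
  one_mem' γ := by
    classical
    rw [one_def, coeff_single, Finsupp.single_apply]
    split_ifs with h
    · exact h ▸ hC.one_mem_zero
    · exact zero_mem _
  add_mem' hp hq γ := add_mem (hp γ) (hq γ)
  zero_mem' γ := zero_mem _
  neg_mem' hp γ := neg_mem (hp γ)

/-- The element of the graded field represented by a sum of homogeneous components. -/
noncomputable def eval : hC.ring →+* K :=
  (coeffSum G K).toRingHom.comp hC.ring.subtype

theorem eval_injective : Function.Injective hC.eval :=
  (injective_iff_map_eq_zero _).2 fun p hp => Subtype.ext (hC.eq_zero p p.2 hp)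

/-- The homogeneous element of degree `γ` with value `x`. -/
noncomputable def monomial (γ : G) (x : C γ) : hC.ring :=
  ⟨single γ (x : K), fun δ => by
    classical
    rw [coeff_single, Finsupp.single_apply]
    split_ifs with h
    · exact h ▸ x.2
    · exact zero_mem _⟩

theorem eval_monomial (γ : G) (x : C γ) : hC.eval (hC.monomial γ x) = x :=
  coeffSum_single γ (x : K)

theorem isUnit_monomial {γ : G} {x : C γ} (hx : (x : K) ≠ 0) : IsUnit (hC.monomial γ x) := by
  refine .of_mul_eq_one (hC.monomial (-γ) ⟨(x : K)⁻¹, hC.inv_mem_neg x.2⟩) (hC.eval_injective ?_)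
  rw [map_mul, eval_monomial, eval_monomial, mul_inv_cancel₀ hx, map_one]

/-- The field of elements of degree zero. -/
def degreeZero : Subfield K where
  carrier := C 0
  mul_mem' hx hy := by simpa using hC.mul_mem_add hx hy
  one_mem' := hC.one_mem_zero
  add_mem' hx hy := add_mem hx hy
  zero_mem' := zero_mem _
  neg_mem' hx := neg_mem hx
  inv_mem' x hx := by simpa using hC.inv_mem_neg hx

/-- The degrees of nonzero homogeneous elements. -/
def degrees : AddSubgroup G where
  carrier := {γ | ∃ x ∈ C γ, x ≠ 0}
  zero_mem' := ⟨1, hC.one_mem_zero, one_ne_zero⟩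
  add_mem' := by
    rintro γ δ ⟨x, hx, hx0⟩ ⟨y, hy, hy0⟩
    exact ⟨x * y, hC.mul_mem_add hx hy, mul_ne_zero hx0 hy0⟩
  neg_mem' := by
    rintro γ ⟨x, hx, hx0⟩
    exact ⟨x⁻¹, hC.inv_mem_neg hx, inv_ne_zero hx0⟩

section MvPolynomial

variable {ι : Type*} {e : ι → G}

/-- The ring homomorphism from a polynomial ring over the field of elements of degree zero that
sends the variables to given homogeneous elements. -/
noncomputable def ofMvPolynomial (e : ι → G) (u : ∀ i, C (e i)) :
    MvPolynomial ι hC.degreeZero →+* hC.ring :=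
  MvPolynomial.eval₂Hom
    ((singleZeroRingHom.comp hC.degreeZero.subtype).codRestrict hC.ring fun x =>
      (hC.monomial 0 ⟨x, x.2⟩).2)
    fun i => hC.monomial (e i) (u i)

theorem coe_ofMvPolynomial_monomial (u : ∀ i, C (e i)) (m : ι →₀ ℕ) (c : hC.degreeZero) :
    (hC.ofMvPolynomial e u (MvPolynomial.monomial m c) : AddMonoidAlgebra K G) =
      single (Finsupp.linearCombination ℕ e m) (c * m.prod fun i n => (u i : K) ^ n) := by
  rw [ofMvPolynomial, MvPolynomial.eval₂Hom_monomial]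
  simp [Finsupp.prod, monomial, single_pow, AddMonoidAlgebra.prod_single, singleZeroRingHom,
    single_mul_single, Finsupp.linearCombination_apply, Finsupp.sum]

theorem prod_pow_mem (hC : IsGradedSubfield C) (u : ∀ i, C (e i)) (m : ι →₀ ℕ) :
    (m.prod fun i n => (u i : K) ^ n) ∈ C (Finsupp.linearCombination ℕ e m) := by
  have h := (hC.ofMvPolynomial e u (MvPolynomial.monomial m 1)).2
    (Finsupp.linearCombination ℕ e m)
  simpa [coe_ofMvPolynomial_monomial] using h

theorem isUnit_ofMvPolynomial_monomial {u : ∀ i, C (e i)} (hu : ∀ i, (u i : K) ≠ 0)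
    (m : ι →₀ ℕ) : IsUnit (hC.ofMvPolynomial e u (MvPolynomial.monomial m 1)) := by
  have h : hC.ofMvPolynomial e u (MvPolynomial.monomial m 1) =
      hC.monomial _ ⟨_, hC.prod_pow_mem u m⟩ :=
    Subtype.ext (by simp [coe_ofMvPolynomial_monomial, monomial])
  rw [h]
  exact hC.isUnit_monomial (prod_pow_ne_zero hu m)

theorem coeff_ofMvPolynomial (u : ∀ i, C (e i)) (P : MvPolynomial ι hC.degreeZero) (γ : G) :
    (hC.ofMvPolynomial e u P).1.coeff γ = ∑ m ∈ P.support,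
      (single (Finsupp.linearCombination ℕ e m)
        (P.coeff m * m.prod fun i n => (u i : K) ^ n)).coeff γ := by
  nth_rewrite 1 [P.as_sum]
  simp only [map_sum, AddSubmonoidClass.coe_finsetSum, coe_ofMvPolynomial_monomial, coeff_sum,
    Finsupp.finsetSum_apply]

theorem ofMvPolynomial_injective (he : LinearIndependent ℕ e) {u : ∀ i, C (e i)}
    (hu : ∀ i, (u i : K) ≠ 0) : Function.Injective (hC.ofMvPolynomial e u) := by
  classical
  refine (injective_iff_map_eq_zero _).2 fun P hP => ?_
  ext m
  by_cases hm : m ∈ P.support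
  · have h := hC.coeff_ofMvPolynomial u P (Finsupp.linearCombination ℕ e m)
    rw [hP, Finset.sum_eq_single_of_mem m hm fun n _ hnm => by
      rw [coeff_single, Finsupp.single_eq_of_ne (fun h => hnm (he h).symm)]] at h
    simpa [prod_pow_ne_zero hu] using h.symm
  · simpa using hm

theorem coeff_ofMvPolynomial_eq_zero (u : ∀ i, C (e i)) (P : MvPolynomial ι hC.degreeZero) {γ : G}
    (hγ : γ ∉ AddSubgroup.closure (Set.range e)) : (hC.ofMvPolynomial e u P).1.coeff γ = 0 := by
  rw [coeff_ofMvPolynomial]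
  refine Finset.sum_eq_zero fun m _ => ?_
  rw [coeff_single, Finsupp.single_eq_of_ne]
  rintro rfl
  refine hγ ?_
  rw [Finsupp.linearCombination_apply]
  exact sum_mem fun i _ => nsmul_mem (AddSubgroup.subset_closure (Set.mem_range_self i)) _

theorem exists_monomial_mul_eq_ofMvPolynomial {u : ∀ i, C (e i)} (hu : ∀ i, (u i : K) ≠ 0) {γ : G}
    (hγ : γ ∈ AddSubgroup.closure (Set.range e)) (x : C γ) : ∃ m P, hC.monomial γ x *
      hC.ofMvPolynomial e u (MvPolynomial.monomial m 1) = hC.ofMvPolynomial e u P := by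
  obtain ⟨m, n, hmn⟩ := exists_add_linearCombination hγ
  have hc : x * (m.prod fun i k => (u i : K) ^ k) * (n.prod fun i k => (u i : K) ^ k)⁻¹ ∈ C 0 := by
    have h := hC.mul_mem_add (hC.mul_mem_add x.2 (hC.prod_pow_mem u m))
      (hC.inv_mem_neg (hC.prod_pow_mem u n))
    rwa [hmn, add_neg_cancel] at h
  refine ⟨m, MvPolynomial.monomial n ⟨_, hc⟩, Subtype.ext ?_⟩
  simp [coe_ofMvPolynomial_monomial, monomial, single_mul_single, hmn, prod_pow_ne_zero hu]

theorem eq_sum_monomial (a : hC.ring) :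
    a = ∑ γ ∈ a.1.coeff.support, hC.monomial γ ⟨a.1.coeff γ, a.2 γ⟩ := by
  refine Subtype.ext ?_
  rw [AddSubmonoidClass.coe_finsetSum]
  exact a.1.sum_coeff_single.symm

theorem exists_mul_eq_ofMvPolynomial {u : ∀ i, C (e i)} (hu : ∀ i, (u i : K) ≠ 0) {a : hC.ring}
    (ha : ∀ γ ∉ AddSubgroup.closure (Set.range e), a.1.coeff γ = 0) :
    ∃ m P, a * hC.ofMvPolynomial e u (MvPolynomial.monomial m 1) = hC.ofMvPolynomial e u P := by
  rw [hC.eq_sum_monomial a]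
  refine Finset.sum_induction _ (fun b => ∃ m P, b * hC.ofMvPolynomial e u
    (MvPolynomial.monomial m 1) = hC.ofMvPolynomial e u P) ?_ ⟨0, 0, by simp⟩ fun γ hγ => ?_
  · rintro b c ⟨m, P, hb⟩ ⟨n, Q, hc⟩
    refine ⟨m + n, P * MvPolynomial.monomial n 1 + Q * MvPolynomial.monomial m 1, ?_⟩
    rw [← one_mul (1 : hC.degreeZero), ← MvPolynomial.monomial_mul, one_mul]
    simp only [map_add, map_mul, ← hb, ← hc]
    ring
  · exact hC.exists_monomial_mul_eq_ofMvPolynomial hu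
      (by_contra fun h => Finsupp.mem_support_iff.1 hγ (ha γ h)) _

end MvPolynomial

section Cosets

variable (N : AddSubgroup G)

open Classical in
/-- The sum of the homogeneous components whose degrees lie in a given coset of `N`. -/
noncomputable def cosetPart (c : G ⧸ N) (a : hC.ring) : hC.ring :=
  ⟨ofCoeff (a.1.coeff.filter fun γ => (γ : G ⧸ N) = c), fun γ => by
    rw [coeff_ofCoeff, Finsupp.filter_apply]
    split_ifs
    · exact a.2 γ
    · exact zero_mem _⟩

open Classical in
theorem coeff_cosetPart (c : G ⧸ N) (a : hC.ring) (γ : G) :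
    (hC.cosetPart N c a).1.coeff γ = if (γ : G ⧸ N) = c then a.1.coeff γ else 0 :=
  Finsupp.filter_apply ..

open Classical in
theorem sum_cosetPart (a : hC.ring) :
    ∑ c ∈ a.1.coeff.support.image (QuotientAddGroup.mk (s := N)), hC.cosetPart N c a = a := by
  ext γ
  rw [AddSubmonoidClass.coe_finsetSum, coeff_sum, Finsupp.finsetSum_apply]
  simp only [coeff_cosetPart, Finset.sum_ite_eq, ite_eq_left_iff]
  intro h
  by_contra hγ
  exact h (Finset.mem_image_of_mem _ (Finsupp.mem_support_iff.2 (Ne.symm hγ)))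

theorem cosetPart_mul (c : G ⧸ N) (a : hC.ring) {b : hC.ring} (hb : ∀ γ ∉ N, b.1.coeff γ = 0) :
    hC.cosetPart N c (a * b) = hC.cosetPart N c a * b := by
  classical
  ext γ
  have hterm : ∀ δ ∈ b.1.coeff.support,
      (hC.cosetPart N c a).1.coeff (γ + -δ) * b.1.coeff δ =
        if (γ : G ⧸ N) = c then a.1.coeff (γ + -δ) * b.1.coeff δ else 0 := fun δ hδ => by
    have hδN : ((γ + -δ : G) : G ⧸ N) = γ := QuotientAddGroup.eq.2 (by
      simpa using by_contra fun h => Finsupp.mem_support_iff.1 hδ (hb δ h))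
    rw [coeff_cosetPart, hδN, ite_zero_mul]
  rw [coeff_cosetPart, Subring.coe_mul, Subring.coe_mul, coeff_mul_apply_right,
    coeff_mul_apply_right, Finsupp.sum, Finsupp.sum, Finset.sum_congr rfl hterm,
    Finset.sum_ite_irrel, Finset.sum_const_zero]

end Cosets

section Coprime

variable {ι : Type*} {e : ι → G} {u : ∀ i, C (e i)}

theorem ofMvPolynomial_dvd_of_support (he : LinearIndependent ℕ e) (hu : ∀ i, (u i : K) ≠ 0)
    {P Q : MvPolynomial ι hC.degreeZero} (hPQ : IsRelPrime P Q) {a b : hC.ring}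
    (ha : ∀ γ ∉ AddSubgroup.closure (Set.range e), a.1.coeff γ = 0)
    (hb : ∀ γ ∉ AddSubgroup.closure (Set.range e), b.1.coeff γ = 0)
    (hab : a * hC.ofMvPolynomial e u Q = hC.ofMvPolynomial e u P * b) :
    hC.ofMvPolynomial e u P ∣ a := by
  obtain ⟨m, A, hA⟩ := hC.exists_mul_eq_ofMvPolynomial hu ha
  obtain ⟨n, B, hB⟩ := hC.exists_mul_eq_ofMvPolynomial hu hb
  have hdvd : P ∣ A * MvPolynomial.monomial n 1 := by
    refine hPQ.dvd_of_dvd_mul_right ⟨B * MvPolynomial.monomial m 1, ?_⟩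
    apply hC.ofMvPolynomial_injective he hu
    simp only [map_mul, ← hA, ← hB]
    linear_combination hC.ofMvPolynomial e u (MvPolynomial.monomial m 1) *
      hC.ofMvPolynomial e u (MvPolynomial.monomial n 1) * hab
  have := map_dvd (hC.ofMvPolynomial e u) hdvd
  rwa [map_mul, (hC.isUnit_ofMvPolynomial_monomial hu n).dvd_mul_right, ← hA,
    (hC.isUnit_ofMvPolynomial_monomial hu m).dvd_mul_right] at this

theorem ofMvPolynomial_dvd_of_isRelPrime (he : LinearIndependent ℕ e) (hu : ∀ i, (u i : K) ≠ 0)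
    {P Q : MvPolynomial ι hC.degreeZero} (hPQ : IsRelPrime P Q) {a : hC.ring}
    (ha : hC.ofMvPolynomial e u P ∣ a * hC.ofMvPolynomial e u Q) :
    hC.ofMvPolynomial e u P ∣ a := by
  classical
  obtain ⟨b, hab⟩ := ha
  set N := AddSubgroup.closure (Set.range e)
  have hsupp (X : MvPolynomial ι hC.degreeZero) :
      ∀ γ ∉ N, (hC.ofMvPolynomial e u X).1.coeff γ = 0 :=
    fun γ hγ => hC.coeff_ofMvPolynomial_eq_zero u X hγ
  rw [← hC.sum_cosetPart N a]
  refine Finset.dvd_sum fun c hc => ?_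
  obtain ⟨γ₀, hγ₀, rfl⟩ := Finset.mem_image.1 hc
  -- The homogeneous component `w` of `a` of degree `γ₀` moves the coset of `γ₀` into `N`.
  have hw : a.1.coeff γ₀ ≠ 0 := Finsupp.mem_support_iff.1 hγ₀
  have hshift (x : hC.ring) : ∀ γ ∉ N, (hC.cosetPart N γ₀ x *
      hC.monomial (-γ₀) ⟨(a.1.coeff γ₀)⁻¹, hC.inv_mem_neg (a.2 γ₀)⟩).1.coeff γ = 0 := by
    intro γ hγ
    rw [Subring.coe_mul, monomial, coeff_mul_single_apply, coeff_cosetPart, if_neg, zero_mul]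
    simpa [QuotientAddGroup.eq] using hγ
  have hparts := hC.cosetPart_mul N γ₀ a (hsupp Q)
  rw [hab, mul_comm, hC.cosetPart_mul N γ₀ b (hsupp P)] at hparts
  have hunit : IsUnit (hC.monomial (-γ₀) ⟨(a.1.coeff γ₀)⁻¹, hC.inv_mem_neg (a.2 γ₀)⟩) :=
    hC.isUnit_monomial (inv_ne_zero hw)
  rw [← hunit.dvd_mul_right]
  refine hC.ofMvPolynomial_dvd_of_support he hu hPQ (hshift a) (hshift b) ?_
  linear_combination -hC.monomial (-γ₀) ⟨_, hC.inv_mem_neg (a.2 γ₀)⟩ * hparts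

theorem exists_linearIndependent_homogeneous [IsAddTorsionFree G] (p q : hC.ring) :
    ∃ (n : ℕ) (e : Fin n → G) (u : ∀ i, C (e i)), LinearIndependent ℕ e ∧ (∀ i, (u i : K) ≠ 0) ∧
      (∀ γ ∉ AddSubgroup.closure (Set.range e), p.1.coeff γ = 0) ∧
      ∀ γ ∉ AddSubgroup.closure (Set.range e), q.1.coeff γ = 0 := by
  obtain ⟨n, e, he, hN⟩ := exists_linearIndependent_closure_eq
    (p.1.coeff.hasFiniteSupport.union q.1.coeff.hasFiniteSupport)
  have hdegrees (i : Fin n) : e i ∈ hC.degrees := by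
    have hi : e i ∈ AddSubgroup.closure (Set.range e) :=
      AddSubgroup.subset_closure (Set.mem_range_self i)
    rw [hN] at hi
    refine (AddSubgroup.closure_le _).2 ?_ hi
    rintro γ (h | h)
    · exact ⟨_, p.2 γ, h⟩
    · exact ⟨_, q.2 γ, h⟩
  choose u hu hu0 using hdegrees
  refine ⟨n, e, fun i => ⟨u i, hu i⟩, ?_, hu0, fun γ hγ => ?_, fun γ hγ => ?_⟩
  · exact he.restrict_scalars (R := ℕ) fun k l hkl => by simpa using hkl
  all_goals
    contrapose! hγ
    rw [hN]
  · exact AddSubgroup.subset_closure (Or.inl hγ)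
  · exact AddSubgroup.subset_closure (Or.inr hγ)

theorem exists_coprime_factors [IsAddTorsionFree G] {p : hC.ring} (hp : p ≠ 0) (q : hC.ring) :
    ∃ d p' q', p = d * p' ∧ q = d * q' ∧ ∀ a, p' ∣ a * q' → p' ∣ a := by
  obtain ⟨k, e, u, he, hu, hpe, hqe⟩ := hC.exists_linearIndependent_homogeneous p q
  obtain ⟨m, P, hP⟩ := hC.exists_mul_eq_ofMvPolynomial hu hpe
  obtain ⟨n, Q, hQ⟩ := hC.exists_mul_eq_ofMvPolynomial hu hqe
  obtain ⟨y, hy⟩ := hC.isUnit_ofMvPolynomial_monomial hu m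
  obtain ⟨z, hz⟩ := hC.isUnit_ofMvPolynomial_monomial hu n
  rw [← hy, ← Units.eq_mul_inv_iff_mul_eq] at hP
  rw [← hz, ← Units.eq_mul_inv_iff_mul_eq] at hQ
  have hP0 : P ≠ 0 := by
    rintro rfl
    exact hp (by rw [hP, map_zero, zero_mul])
  obtain ⟨P', Q', c, hrel, rfl, rfl⟩ := UniqueFactorizationMonoid.exists_reduced_factors P hP0 Q
  refine ⟨hC.ofMvPolynomial e u c, hC.ofMvPolynomial e u P' * ↑y⁻¹,
    hC.ofMvPolynomial e u Q' * ↑z⁻¹, by rw [hP, map_mul, mul_assoc],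
    by rw [hQ, map_mul, mul_assoc], fun a ha => ?_⟩
  rw [← mul_assoc, y⁻¹.isUnit.mul_right_dvd, z⁻¹.isUnit.dvd_mul_right] at ha
  exact y⁻¹.isUnit.mul_right_dvd.2 (hC.ofMvPolynomial_dvd_of_isRelPrime he hu hrel ha)

end Coprime

end IsGradedSubfield

end GradedSubfield

section GradedDomain

variable {G K D : Type*} [Field K] [CommRing D] [Algebra D K] {C : G → AddSubgroup K}

/-- Every module spanned by finitely many homogeneous elements, not all of them zero, is
`⋆_f`-invertible. For graded `D` this is the graded P`⋆`MD property, phrased with fractional ideals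
so as to apply to the contents of elements. -/
def HomogeneousSpansInvertible (C : G → AddSubgroup K) (s : SemistarOperation D K) : Prop :=
  ∀ S : Set K, S.Finite → (∀ x ∈ S, ∃ γ, x ∈ C γ) → (∃ x ∈ S, x ≠ 0) →
    IsStarInvertible s (Submodule.span D S)

theorem HomogeneousSpansInvertible.mono {s s' : SemistarOperation D K} (h : ∀ E, s E ≤ s' E)
    (hs : HomogeneousSpansInvertible C s) : HomogeneousSpansInvertible C s' :=
  fun S hfin hS hS0 => (hs S hfin hS hS0).mono h

namespace IsGradedSubfield

variable [AddCommGroup G] (hC : IsGradedSubfield C)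

theorem eval_mem_content (p : hC.ring) : hC.eval p ∈ content D p.1 :=
  coeffSum_mem (coeff_mem_content p.1)

variable (E : Submodule D K)

/-- The homogeneous core of `E`: the sums of homogeneous elements of `E`. -/
def homogeneousCore : AddSubgroup K where
  carrier := {x | ∃ p : hC.ring, content D p.1 ≤ E ∧ hC.eval p = x}
  zero_mem' := ⟨0, content_le_iff.2 fun _ => zero_mem _, map_zero _⟩
  add_mem' := by
    rintro _ _ ⟨p, hp, rfl⟩ ⟨q, hq, rfl⟩
    rw [content_le_iff] at hp hq
    exact ⟨p + q, content_le_iff.2 fun γ => add_mem (hp γ) (hq γ), map_add _ _ _⟩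
  neg_mem' := by
    rintro _ ⟨p, hp, rfl⟩
    rw [content_le_iff] at hp
    exact ⟨-p, content_le_iff.2 fun γ => neg_mem (hp γ), map_neg _ _⟩

/-- Homogeneous submodules of `K`. In particular, `IsHomogeneous 1` says that the base ring `D` is
graded by the groups `D ∩ C γ`. -/
def IsHomogeneous : Prop := ∀ x ∈ E, x ∈ hC.homogeneousCore E

variable {hC} {E}

theorem IsHomogeneous.content_le (hE : hC.IsHomogeneous E) {p : hC.ring}
    (hp : hC.eval p ∈ E) : content D p.1 ≤ E := by
  obtain ⟨q, hqE, hqp⟩ := hE _ hp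
  rwa [← hC.eval_injective hqp]

theorem IsHomogeneous.mul {F : Submodule D K} (hE : hC.IsHomogeneous E)
    (hF : hC.IsHomogeneous F) : hC.IsHomogeneous (E * F) := by
  intro x hx
  induction hx using Submodule.mul_induction_on' with
  | mem_mul_mem y hy z hz =>
    obtain ⟨p, hpE, rfl⟩ := hE y hy
    obtain ⟨q, hqF, rfl⟩ := hF z hz
    exact ⟨p * q, (content_mul_le p.1 q.1).trans (mul_le_mul' hpE hqF), map_mul _ _ _⟩
  | add y _ z _ hy hz => exact add_mem hy hz

theorem mem_homogeneousCore_of_mem {γ : G} {x : C γ} (hx : (x : K) ∈ E) :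
    (x : K) ∈ hC.homogeneousCore E := by
  classical
  refine ⟨hC.monomial γ x, content_le_iff.2 fun δ => ?_, hC.eval_monomial γ x⟩
  rw [monomial, AddMonoidAlgebra.coeff_single, Finsupp.single_apply]
  split_ifs
  · exact hx
  · exact zero_mem _

theorem isHomogeneous_span (hD : hC.IsHomogeneous (1 : Submodule D K)) {S : Set K}
    (hS : ∀ x ∈ S, ∃ γ, x ∈ C γ) :
    hC.IsHomogeneous (Submodule.span D S) := by
  intro x hx
  induction hx using Submodule.span_induction with
  | mem x hx =>
    obtain ⟨γ, hγ⟩ := hS x hx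
    exact mem_homogeneousCore_of_mem (x := ⟨x, hγ⟩) (Submodule.subset_span hx)
  | zero => exact zero_mem _
  | add y z _ _ hy hz => exact add_mem hy hz
  | smul c y _ hy =>
    obtain ⟨p, hpE, rfl⟩ := hy
    obtain ⟨q, hq1, hqc⟩ := hD (algebraMap D K c) (Submodule.mem_one.2 ⟨c, rfl⟩)
    refine ⟨q * p, ?_, by rw [map_mul, hqc, Algebra.smul_def]⟩
    exact (content_mul_le q.1 p.1).trans ((mul_le_mul' hq1 hpE).trans_eq (one_mul _))

theorem isHomogeneous_one_div_span (hD : hC.IsHomogeneous (1 : Submodule D K)) {S : Set K}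
    (hS : ∀ x ∈ S, ∃ γ, x ∈ C γ) (hS0 : ∃ x ∈ S, x ≠ 0) :
    hC.IsHomogeneous (1 / Submodule.span D S) := by
  intro x hx
  rw [mem_one_div_span] at hx
  obtain ⟨a, haS, ha0⟩ := hS0
  obtain ⟨γ, hγ⟩ := hS a haS
  obtain ⟨p, -, hp⟩ := hD _ (hx a haS)
  set q := p * hC.monomial (-γ) ⟨a⁻¹, hC.inv_mem_neg hγ⟩
  have hqx : hC.eval q = x := by
    rw [map_mul, eval_monomial, hp, mul_inv_cancel_right₀ ha0]
  refine ⟨q, content_le_iff.2 fun η => mem_one_div_span.2 fun b hb => ?_, hqx⟩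
  obtain ⟨δ, hδ⟩ := hS b hb
  have hqb : hC.eval (q * hC.monomial δ ⟨b, hδ⟩) ∈ (1 : Submodule D K) := by
    rw [map_mul, hqx, eval_monomial]
    exact hx b hb
  have := content_le_iff.1 (hD.content_le hqb) (η + δ)
  rwa [Subring.coe_mul, monomial, AddMonoidAlgebra.coeff_mul_single_add] at this

theorem isStarInvertible_content_sup {s : SemistarOperation D K}
    (hinv : HomogeneousSpansInvertible C s) {p : hC.ring} (hp : p ≠ 0) (q : hC.ring) :
    IsStarInvertible s (content D p.1 ⊔ content D q.1) := by
  rw [content, content, ← Submodule.span_union]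
  refine hinv _ ((Finsupp.finite_range _).union (Finsupp.finite_range _)) ?_ ?_
  · rintro _ (⟨γ, rfl⟩ | ⟨γ, rfl⟩)
    exacts [⟨γ, p.2 γ⟩, ⟨γ, q.2 γ⟩]
  · by_contra! hcon
    exact hp (by ext γ; exact hcon _ (.inl ⟨γ, rfl⟩))

theorem content_mul_content_le_one [FaithfulSMul D K] [IsAddTorsionFree G]
    (hinv : HomogeneousSpansInvertible C (SemistarOperation.v D K)) {p q : hC.ring} (hp : p ≠ 0)
    (hq : q ≠ 0) (hpq : content D (p * q).1 ≤ 1) : content D p.1 * content D q.1 ≤ 1 := by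
  have := twoUniqueSums_of_isAddTorsionFree G
  have hcontent {r : hC.ring} (hr : r ≠ 0) :
      IsStarInvertible (SemistarOperation.v D K) (content D r.1) := by
    simpa only [sup_idem] using isStarInvertible_content_sup hinv hr r
  calc content D p.1 * content D q.1 ≤ SemistarOperation.t D K (content D (p * q).1) :=
        content_mul_content_le_finiteType (hcontent hp) (hcontent hq)
    _ ≤ SemistarOperation.t D K 1 := SemistarOperation.monotone _ hpq
    _ = 1 := SemistarOperation.t_one

/-- The inverses of the pair and of the content ideal agree: a multiplier of the pair into `D` is
homogeneous by coprimality, and Gauss' lemma spreads it over the coefficients. -/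
theorem isStarInvertible_v_span_pair_of_coprime [FaithfulSMul D K] [IsAddTorsionFree G]
    (hD : hC.IsHomogeneous (1 : Submodule D K))
    (hinv : HomogeneousSpansInvertible C (SemistarOperation.v D K))
    {p q : hC.ring} (hp : p ≠ 0) (hq : q ≠ 0) (hpq : ∀ a, p ∣ a * q → p ∣ a) :
    IsStarInvertible (SemistarOperation.v D K) (Submodule.span D {hC.eval p, hC.eval q}) := by
  have hp0 : hC.eval p ≠ 0 := (map_ne_zero_iff _ hC.eval_injective).2 hp
  set J := content D p.1 ⊔ content D q.1
  have hle : Submodule.span D {hC.eval p, hC.eval q} ≤ J := by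
    rw [Submodule.span_le, Set.insert_subset_iff, Set.singleton_subset_iff]
    exact ⟨le_sup_left (a := content D p.1) (hC.eval_mem_content p),
      le_sup_right (b := content D q.1) (hC.eval_mem_content q)⟩
  refine .of_le_apply (Submodule.fg_span (by simp)) hle
    (SemistarOperation.le_v_of_one_div_le ?_ fun x hx => ?_)
    (isStarInvertible_content_sup hinv hp q)
  · exact (Submodule.ne_bot_iff _).2 ⟨_, Submodule.subset_span (.inl rfl), hp0⟩
  simp only [mem_one_div_span, Set.mem_insert_iff, Set.mem_singleton_iff, forall_eq_or_imp,
    forall_eq] at hx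
  obtain ⟨a, ha, hax⟩ := hD _ hx.1
  obtain ⟨b, hb, hbx⟩ := hD _ hx.2
  obtain ⟨c, rfl⟩ := hpq a ⟨b, hC.eval_injective (by rw [map_mul, map_mul, hax, hbx]; ring)⟩
  obtain rfl : hC.eval c = x := mul_right_cancel₀ hp0 (by rw [← hax, map_mul, mul_comm])
  obtain rfl : b = c * q := hC.eval_injective (by rw [hbx, map_mul])
  rcases eq_or_ne c 0 with rfl | hc
  · rw [map_zero]
    exact zero_mem _
  refine (Submodule.le_div_iff_mul_le.2 ?_) (hC.eval_mem_content c)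
  rw [Submodule.mul_sup]
  rw [mul_comm p c] at ha
  exact sup_le (content_mul_content_le_one hinv hc hp ha) (content_mul_content_le_one hinv hc hq hb)

theorem isPvMD [IsDomain D] [IsFractionRing D K] [IsAddTorsionFree G]
    (hD : hC.IsHomogeneous (1 : Submodule D K))
    (hinv : HomogeneousSpansInvertible C (SemistarOperation.v D K)) : IsPvMD D K := by
  classical
  refine isPStarMD_of_pair fun x y hx hy => ?_
  obtain ⟨⟨b, hb⟩, hbxy⟩ :=
    IsLocalization.exist_integer_multiples_of_finset (nonZeroDivisors D) ({x, y} : Finset K)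
  have hb0 : algebraMap D K b ≠ 0 := IsFractionRing.to_map_ne_zero_of_mem_nonZeroDivisors hb
  simp only [Finset.mem_insert, Finset.mem_singleton, forall_eq_or_imp, forall_eq,
    Algebra.smul_def] at hbxy
  obtain ⟨p, -, hp⟩ := hD _ (Submodule.mem_one.2 hbxy.1)
  obtain ⟨q, -, hq⟩ := hD _ (Submodule.mem_one.2 hbxy.2)
  have hp0 : hC.eval p ≠ 0 := hp ▸ mul_ne_zero hb0 hx
  have hq0 : hC.eval q ≠ 0 := hq ▸ mul_ne_zero hb0 hy
  obtain ⟨d, p', q', rfl, rfl, hcoprime⟩ :=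
    hC.exists_coprime_factors (ne_zero_of_map hp0) q
  rw [map_mul] at hp hq hp0 hq0
  have hspan : Submodule.span D {x, y} =
      Submodule.span D {(algebraMap D K b)⁻¹ * hC.eval d} *
        Submodule.span D {hC.eval p', hC.eval q'} := by
    rw [Submodule.span_mul_span, Set.singleton_mul, Set.image_pair, mul_assoc, mul_assoc, hp, hq,
      inv_mul_cancel_left₀ hb0, inv_mul_cancel_left₀ hb0]
  rw [hspan]
  exact (IsStarInvertible.span_singleton _
    (mul_ne_zero (inv_ne_zero hb0) (left_ne_zero_of_mul hp0))).mul
      (isStarInvertible_v_span_pair_of_coprime hD hinv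
        (ne_zero_of_map (right_ne_zero_of_mul hp0)) (ne_zero_of_map (right_ne_zero_of_mul hq0))
        hcoprime)

end IsGradedSubfield

end GradedDomain

section GrothendieckGroup

open Algebra

theorem exists_eq_of_sub_of {Γ : Type*} [AddCommMonoid Γ] (x : GrothendieckAddGroup Γ) :
    ∃ α β : Γ, x = GrothendieckAddGroup.of α - GrothendieckAddGroup.of β := by
  obtain ⟨⟨α, β⟩, h⟩ := (AddLocalization.addMonoidOf (⊤ : AddSubmonoid Γ)).surj x
  exact ⟨α, β, eq_sub_of_add_eq h⟩

theorem isAddTorsionFree_grothendieckAddGroup (Γ : Type*) [AddCommMonoid Γ] [IsCancelAdd Γ]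
    [IsAddTorsionFree Γ] : IsAddTorsionFree (GrothendieckAddGroup Γ) := by
  refine ⟨fun n hn x y hxy => ?_⟩
  obtain ⟨α, β, hαβ⟩ := exists_eq_of_sub_of (x - y)
  have h : n • (x - y) = 0 := by rw [nsmul_sub]; exact sub_eq_zero.2 hxy
  rw [hαβ, nsmul_sub, sub_eq_zero, ← map_nsmul, ← map_nsmul] at h
  rw [← sub_eq_zero, hαβ, nsmul_right_injective hn (GrothendieckAddGroup.of_injective h), sub_self]

end GrothendieckGroup

section HomogeneousIdeal

variable {D ι : Type*} [CommRing D] {𝒟 : ι → AddSubgroup D}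

theorem isHomogeneousIdeal_span {S : Set D} (hS : ∀ x ∈ S, SetLike.IsHomogeneousElem 𝒟 x) :
    IsHomogeneousIdeal 𝒟 (Ideal.span S) := by
  refine le_antisymm (Ideal.homogeneousCore'_le 𝒟 _) (Ideal.span_le.2 fun x hx => ?_)
  exact Ideal.subset_span ⟨⟨x, hS x hx⟩, Ideal.subset_span hx, rfl⟩

theorem IsHomogeneousIdeal.span_eq {I : Ideal D} (hI : IsHomogeneousIdeal 𝒟 I) :
    Ideal.span {x | x ∈ I ∧ SetLike.IsHomogeneousElem 𝒟 x} = I := by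
  refine le_antisymm (Ideal.span_le.2 fun x hx => hx.1) ?_
  nth_rewrite 1 [← hI]
  refine Ideal.span_mono ?_
  rintro _ ⟨x, hx, rfl⟩
  exact ⟨hx, x.2⟩

theorem IsHomogeneousIdeal.exists_finset {I : Ideal D} (hI : IsHomogeneousIdeal 𝒟 I) (hfg : I.FG) :
    ∃ S : Finset D, (∀ x ∈ S, SetLike.IsHomogeneousElem 𝒟 x) ∧ Ideal.span (S : Set D) = I := by
  rw [← hI.span_eq] at hfg
  obtain ⟨S, hS, hSI⟩ := (Submodule.fg_span_iff_fg_span_finset_subset _).1 hfg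
  exact ⟨S, fun x hx => (hS hx).2, hSI.symm.trans hI.span_eq⟩

end HomogeneousIdeal

section HomogeneousQuotientField

open Algebra AddMonoidAlgebra

variable {Γ R : Type*} [AddCommMonoid Γ] [DecidableEq Γ] [CommRing R]
  (𝒜 : Γ → AddSubgroup R) [GradedRing 𝒜] (K : Type*) [Field K] [Algebra R K]

/-- The coaction of the grading of `R`: an element of degree `α` is sent to its multiple of the
group element `α`, so that the homogeneous components of `r` are the coefficients of its image. -/
noncomputable def toGroupAlgebra : R →+* AddMonoidAlgebra K (GrothendieckAddGroup Γ) :=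
  (DirectSum.toSemiring
    (fun α => (singleAddHom (GrothendieckAddGroup.of α)).comp
      ((algebraMap R K).toAddMonoidHom.comp (𝒜 α).subtype))
    (by simp [one_def])
    (by simp [single_mul_single])).comp (DirectSum.decomposeRingEquiv 𝒜).toRingHom

variable {𝒜}

theorem toGroupAlgebra_of_mem {α : Γ} {r : R} (hr : r ∈ 𝒜 α) :
    toGroupAlgebra 𝒜 K r = single (GrothendieckAddGroup.of α) (algebraMap R K r) := by
  change DirectSum.toAddMonoid _ (DirectSum.decompose 𝒜 r) = _
  rw [DirectSum.decompose_of_mem 𝒜 hr, DirectSum.toAddMonoid_of]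
  rfl

theorem isUnit_toGroupAlgebra [FaithfulSMul R K] {h : R} (hh : SetLike.IsHomogeneousElem 𝒜 h)
    (h0 : h ≠ 0) :
    IsUnit (toGroupAlgebra 𝒜 K h) := by
  obtain ⟨α, hα⟩ := hh
  rw [toGroupAlgebra_of_mem K hα]
  refine .of_mul_eq_one (single (-GrothendieckAddGroup.of α) (algebraMap R K h)⁻¹) ?_
  rw [single_mul_single, add_neg_cancel,
    mul_inv_cancel₀ ((map_ne_zero_iff _ (FaithfulSMul.algebraMap_injective R K)).2 h0), one_def]

variable [IsCancelAdd Γ]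

theorem coeff_toGroupAlgebra (r : R) (α : Γ) :
    (toGroupAlgebra 𝒜 K r).coeff (GrothendieckAddGroup.of α) =
      algebraMap R K (DirectSum.decompose 𝒜 r α) := by
  induction r using DirectSum.Decomposition.inductionOn 𝒜 with
  | zero => simp
  | @homogeneous β r =>
    rw [toGroupAlgebra_of_mem K r.2, coeff_single, DirectSum.decompose_coe]
    rcases eq_or_ne β α with rfl | h
    · simp
    · rw [DirectSum.of_eq_of_ne _ _ _ h.symm, Finsupp.single_eq_of_ne'
        (GrothendieckAddGroup.of_injective.ne h), ZeroMemClass.coe_zero, map_zero]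
  | add r r' h h' =>
    rw [map_add, coeff_add, Finsupp.add_apply, h, h', DirectSum.decompose_add, DirectSum.add_apply,
      AddMemClass.coe_add, map_add]

variable [IsDomain R] [IsFractionRing R K] {K}

theorem toGroupAlgebra_mul_single {γ : GrothendieckAddGroup Γ} {x : K}
    (hx : x ∈ homogeneousQuotientFieldComponent 𝒜 K γ) {h r : R}
    (hr : algebraMap R K h * x = algebraMap R K r) :
    toGroupAlgebra 𝒜 K h * single γ x = toGroupAlgebra 𝒜 K r := by
  rcases hx with rfl | ⟨α, β, a, ha, b, hb, hb0, rfl, rfl⟩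
  · rw [mul_zero, eq_comm, FaithfulSMul.algebraMap_eq_zero_iff] at hr
    rw [single_zero, mul_zero, hr, map_zero]
  have hbK : algebraMap R K b ≠ 0 := (map_ne_zero_iff _ (IsFractionRing.injective R K)).2 hb0
  have hab : h * a = r * b := by
    rw [mul_div_assoc', div_eq_iff hbK, ← map_mul, ← map_mul] at hr
    exact IsFractionRing.injective R K hr
  rw [← (isUnit_toGroupAlgebra K ⟨β, hb⟩ hb0).mul_left_inj, ← map_mul, ← hab, map_mul, mul_assoc,
    toGroupAlgebra_of_mem K hb, single_mul_single, sub_add_cancel, div_mul_cancel₀ _ hbK,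
    toGroupAlgebra_of_mem K ha]

theorem algebraMap_mem_component {α : Γ} {r : R} (hr : r ∈ 𝒜 α) :
    algebraMap R K r ∈ homogeneousQuotientFieldComponent 𝒜 K (GrothendieckAddGroup.of α) :=
  Or.inr ⟨α, 0, r, hr, 1, SetLike.GradedOne.one_mem, one_ne_zero, by simp, by simp⟩

theorem isHomogeneousElem_of_algebraMap_mem {r : R} {γ : GrothendieckAddGroup Γ}
    (hr : algebraMap R K r ∈ homogeneousQuotientFieldComponent 𝒜 K γ) :
    SetLike.IsHomogeneousElem 𝒜 r := by
  rcases eq_or_ne r 0 with rfl | hr0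
  · exact ⟨0, zero_mem _⟩
  have hne : DirectSum.decompose 𝒜 r ≠ 0 := by
    rwa [Ne, ← DirectSum.decompose_zero 𝒜, (DirectSum.decompose 𝒜).apply_eq_iff_eq]
  obtain ⟨α, hα⟩ := DFinsupp.ne_iff.1 hne
  have hsingle : single γ (algebraMap R K r) = toGroupAlgebra 𝒜 K r := by
    rw [← toGroupAlgebra_mul_single (h := 1) hr (by rw [map_one, one_mul]), map_one, one_mul]
  have hcoeff := coeff_toGroupAlgebra (𝒜 := 𝒜) K r α
  classical
  rw [← hsingle, coeff_single, Finsupp.single_apply] at hcoeff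
  split_ifs at hcoeff
  · exact ⟨α, IsFractionRing.injective R K hcoeff ▸ SetLike.coe_mem _⟩
  · rw [eq_comm, FaithfulSMul.algebraMap_eq_zero_iff] at hcoeff
    exact absurd (Subtype.ext hcoeff) hα

theorem exists_common_denominator (S : Finset K)
    (hS : ∀ x ∈ S, ∃ γ, x ∈ homogeneousQuotientFieldComponent 𝒜 K γ) :
    ∃ h : R, SetLike.IsHomogeneousElem 𝒜 h ∧ h ≠ 0 ∧
      ∀ x ∈ S, ∃ r : R, SetLike.IsHomogeneousElem 𝒜 r ∧
        algebraMap R K h * x = algebraMap R K r := by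
  classical
  have hfrac : ∀ x ∈ S, ∃ a b, SetLike.IsHomogeneousElem 𝒜 a ∧ SetLike.IsHomogeneousElem 𝒜 b ∧
      b ≠ 0 ∧ algebraMap R K b * x = algebraMap R K a := by
    intro x hx
    obtain ⟨γ, rfl | ⟨α, β, a, ha, b, hb, hb0, -, rfl⟩⟩ := hS x hx
    · exact ⟨0, 1, ⟨0, zero_mem _⟩, ⟨0, SetLike.GradedOne.one_mem⟩, one_ne_zero, by simp⟩
    · exact ⟨a, b, ⟨α, ha⟩, ⟨β, hb⟩, hb0, mul_div_cancel₀ _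
        ((map_ne_zero_iff _ (IsFractionRing.injective R K)).2 hb0)⟩
  choose! a b ha hb hb0 hab using hfrac
  have hprod (U : Finset K) (hU : U ⊆ S) : SetLike.IsHomogeneousElem 𝒜 (∏ y ∈ U, b y) :=
    (SetLike.homogeneousSubmonoid 𝒜).prod_mem fun y hy => hb y (hU hy)
  refine ⟨∏ y ∈ S, b y, hprod S subset_rfl, Finset.prod_ne_zero_iff.2 hb0, fun x hx =>
    ⟨(∏ y ∈ S.erase x, b y) * a x, (hprod _ (S.erase_subset x)).mul (ha x hx), ?_⟩⟩
  rw [← Finset.prod_erase_mul S b hx, map_mul, map_mul, mul_assoc, hab x hx]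

theorem eq_zero_of_mem_component_of_coeffSum_eq_zero
    {p : AddMonoidAlgebra K (GrothendieckAddGroup Γ)}
    (hp : ∀ γ, p.coeff γ ∈ homogeneousQuotientFieldComponent 𝒜 K γ) (hsum : coeffSum _ K p = 0) :
    p = 0 := by
  classical
  obtain ⟨h, hh, h0, hden⟩ := exists_common_denominator (𝒜 := 𝒜) (p.coeff.support.image p.coeff)
    (Finset.forall_mem_image.2 fun γ _ => ⟨γ, hp γ⟩)
  choose! r hr using fun γ (hγ : γ ∈ p.coeff.support) =>
    (hden _ (Finset.mem_image_of_mem p.coeff hγ)).imp fun _ => And.right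
  have hrsum : ∑ γ ∈ p.coeff.support, r γ = 0 := by
    rw [← FaithfulSMul.algebraMap_eq_zero_iff R K, map_sum, ← Finset.sum_congr rfl hr,
      ← Finset.mul_sum, ← coeffSum_eq_sum, hsum, mul_zero]
  rw [← (isUnit_toGroupAlgebra K hh h0).mul_right_eq_zero]
  calc toGroupAlgebra 𝒜 K h * p
      = ∑ γ ∈ p.coeff.support, toGroupAlgebra 𝒜 K h * single γ (p.coeff γ) := by
        rw [← Finset.mul_sum]
        congr 1
        exact (sum_coeff_single p).symm
    _ = ∑ γ ∈ p.coeff.support, toGroupAlgebra 𝒜 K (r γ) :=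
        Finset.sum_congr rfl fun γ hγ => toGroupAlgebra_mul_single (hp γ) (hr γ hγ)
    _ = 0 := by rw [← map_sum, hrsum, map_zero]

variable (𝒜 K) in
theorem isGradedSubfield_component :
    IsGradedSubfield (homogeneousQuotientFieldComponent 𝒜 K) where
  one_mem_zero := by
    simpa using algebraMap_mem_component (K := K) (SetLike.GradedOne.one_mem (A := 𝒜))
  mul_mem_add := by
    rintro γ δ _ _ (rfl | ⟨α, β, a, ha, b, hb, hb0, rfl, rfl⟩) hy
    · rw [zero_mul]
      exact zero_mem _
    rcases hy with rfl | ⟨α', β', a', ha', b', hb', hb0', rfl, rfl⟩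
    · rw [mul_zero]
      exact zero_mem _
    refine Or.inr ⟨α + α', β + β', a * a', SetLike.mul_mem_graded ha ha', b * b',
      SetLike.mul_mem_graded hb hb', mul_ne_zero hb0 hb0', ?_, ?_⟩
    · rw [map_add, map_add, add_sub_add_comm]
    · rw [map_mul, map_mul, div_mul_div_comm]
  inv_mem_neg := by
    rintro γ _ (rfl | ⟨α, β, a, ha, b, hb, -, rfl, rfl⟩)
    · rw [inv_zero]
      exact zero_mem _
    rcases eq_or_ne a 0 with rfl | ha0
    · rw [map_zero, zero_div, inv_zero]
      exact zero_mem _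
    · exact Or.inr ⟨β, α, b, hb, a, ha, ha0, neg_sub _ _, inv_div _ _⟩
  eq_zero _ := eq_zero_of_mem_component_of_coeffSum_eq_zero

theorem component_le_homogeneousQuotientField {γ : GrothendieckAddGroup Γ} {x : K}
    (hx : x ∈ homogeneousQuotientFieldComponent 𝒜 K γ) : x ∈ homogeneousQuotientField 𝒜 K := by
  rcases hx with rfl | ⟨α, β, a, -, b, hb, hb0, -, rfl⟩
  · exact zero_mem _
  · exact ⟨a, b, ⟨⟨β, hb⟩, mem_nonZeroDivisors_of_ne_zero hb0⟩, div_eq_mul_inv _ _⟩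

end HomogeneousQuotientField

section GradedPStarMD

variable {G K D ι : Type*} [Field K] [CommRing D] [Algebra D K]
  {C : G → AddSubgroup K} {𝒟 : ι → AddSubgroup D} {s : SemistarOperation D K}

theorem HomogeneousSpansInvertible.isGradedPStarMD [FaithfulSMul D K]
    (h : HomogeneousSpansInvertible C s)
    (hC : ∀ a : D, SetLike.IsHomogeneousElem 𝒟 a → ∃ γ, algebraMap D K a ∈ C γ) :
    IsGradedPStarMD 𝒟 s := by
  intro I hfg hI0 hI
  obtain ⟨S, hS, rfl⟩ := hI.exists_finset hfg
  rw [IsLocalization.coeSubmodule_span]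
  refine h _ (S.finite_toSet.image _) (Set.forall_mem_image.2 fun a ha => hC a (hS a ha)) ?_
  rw [Ne, Ideal.span_eq_bot] at hI0
  push Not at hI0
  obtain ⟨a, haS, ha0⟩ := hI0
  exact ⟨_, ⟨a, haS, rfl⟩, (map_ne_zero_iff _ (FaithfulSMul.algebraMap_injective D K)).2 ha0⟩

theorem IsGradedPStarMD.homogeneousSpansInvertible (h : IsGradedPStarMD 𝒟 s)
    (hC : ∀ S : Set K, S.Finite → (∀ x ∈ S, ∃ γ, x ∈ C γ) → ∃ k : K, k ≠ 0 ∧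
      ∀ x ∈ S, ∃ a : D, SetLike.IsHomogeneousElem 𝒟 a ∧ k * x = algebraMap D K a) :
    HomogeneousSpansInvertible C s := by
  intro S hfin hS ⟨x, hxS, hx0⟩
  obtain ⟨k, hk0, hk⟩ := hC S hfin hS
  choose! a ha hka using hk
  have hspan : IsLocalization.coeSubmodule K (Ideal.span (a '' S)) =
      Submodule.span D S * Submodule.span D {k} := by
    rw [IsLocalization.coeSubmodule_span, Set.image_image, mul_comm, Submodule.span_mul_span,
      Set.singleton_mul]
    exact congrArg _ (Set.image_congr fun y hy => (hka y hy).symm)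
  refine IsStarInvertible.of_mul (hspan ▸ h _ (Submodule.fg_span (hfin.image a)) (fun hbot => ?_)
    (isHomogeneousIdeal_span (Set.forall_mem_image.2 ha)))
  refine mul_ne_zero hk0 hx0 ?_
  rw [hka x hxS, Ideal.span_eq_bot.1 hbot _ ⟨x, hxS, rfl⟩, map_zero]

end GradedPStarMD

section HomogeneousOverring

open Algebra

theorem mem_one_subalgebra {R K : Type*} [CommRing R] [CommRing K] [Algebra R K]
    {T : Subalgebra R K} {x : K} : x ∈ (1 : Submodule T K) ↔ x ∈ T := by
  rw [Submodule.mem_one]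
  exact ⟨fun ⟨y, hy⟩ => hy ▸ y.2, fun h => ⟨⟨x, h⟩, rfl⟩⟩

variable {Γ R K : Type*} [AddCommMonoid Γ] [IsCancelAdd Γ] [DecidableEq Γ] [CommRing R]
  [IsDomain R] [Field K] [Algebra R K] [IsFractionRing R K] {𝒜 : Γ → AddSubgroup R} [GradedRing 𝒜]
  {T : Subalgebra R K}

variable (𝒜) in
theorem isHomogeneous_one : (isGradedSubfield_component 𝒜 K).IsHomogeneous (1 : Submodule R K) := by
  intro x hx
  obtain ⟨r, rfl⟩ := Submodule.mem_one.1 hx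
  clear hx
  induction r using DirectSum.Decomposition.inductionOn 𝒜 with
  | zero =>
    rw [map_zero]
    exact zero_mem _
  | @homogeneous α r =>
    exact IsGradedSubfield.mem_homogeneousCore_of_mem (x := ⟨_, algebraMap_mem_component r.2⟩)
      (Submodule.mem_one.2 ⟨r, rfl⟩)
  | add r r' h h' =>
    rw [map_add]
    exact add_mem h h'

theorem isHomogeneousOverring_iff : IsHomogeneousOverring 𝒜 T ↔
    (isGradedSubfield_component 𝒜 K).IsHomogeneous (1 : Submodule T K) := by
  constructor
  · intro hT x hx
    have hx' : x ∈ T.toSubring.toAddSubgroup := mem_one_subalgebra.1 hx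
    rw [hT.eq_iSup] at hx'
    refine (iSup_le fun γ => ?_ : _ ≤ IsGradedSubfield.homogeneousCore _ _) hx'
    rintro y ⟨hyT, hyC⟩
    exact IsGradedSubfield.mem_homogeneousCore_of_mem (x := ⟨y, hyC⟩) (mem_one_subalgebra.2 hyT)
  · intro h
    refine ⟨fun x hx => ?_, le_antisymm (fun x hx => ?_) (iSup_le fun γ => inf_le_left)⟩
    · obtain ⟨p, -, rfl⟩ := h x (mem_one_subalgebra.2 hx)
      exact coeffSum_mem fun γ => component_le_homogeneousQuotientField (p.2 γ)
    · obtain ⟨p, hp, rfl⟩ := h x (mem_one_subalgebra.2 hx)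
      exact coeffSum_mem fun γ => AddSubgroup.mem_iSup_of_mem γ
        ⟨mem_one_subalgebra.1 (content_le_iff.1 hp γ), p.2 γ⟩

theorem isHomogeneousOverring_adjoin {S : Set K}
    (hS : ∀ x ∈ S, ∃ γ, x ∈ homogeneousQuotientFieldComponent 𝒜 K γ) :
    IsHomogeneousOverring 𝒜 (Algebra.adjoin R S) := by
  rw [isHomogeneousOverring_iff]
  intro x hx
  rw [mem_one_subalgebra] at hx
  induction hx using Algebra.adjoin_induction with
  | mem x hx =>
    obtain ⟨γ, hγ⟩ := hS x hx
    exact IsGradedSubfield.mem_homogeneousCore_of_mem (x := ⟨x, hγ⟩)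
      (mem_one_subalgebra.2 (Algebra.subset_adjoin hx))
  | algebraMap r =>
    obtain ⟨p, hp, hpr⟩ := isHomogeneous_one 𝒜 (algebraMap R K r) (Submodule.mem_one.2 ⟨r, rfl⟩)
    refine ⟨p, content_le_iff.2 fun γ => mem_one_subalgebra.2 ?_, hpr⟩
    obtain ⟨r', hr'⟩ := Submodule.mem_one.1 (content_le_iff.1 hp γ)
    exact hr' ▸ Subalgebra.algebraMap_mem _ r'
  | add y z _ _ hy hz => exact add_mem hy hz
  | mul y z _ _ hy hz =>
    obtain ⟨p, hp, rfl⟩ := hy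
    obtain ⟨q, hq, rfl⟩ := hz
    exact ⟨p * q, (content_mul_le p.1 q.1).trans (by simpa using mul_le_mul' hp hq), map_mul _ _ _⟩

theorem isGradedPStarMD_iff {s : SemistarOperation R K} : IsGradedPStarMD 𝒜 s ↔
    HomogeneousSpansInvertible (homogeneousQuotientFieldComponent 𝒜 K) s := by
  refine ⟨fun h => h.homogeneousSpansInvertible fun S hfin hS => ?_,
    fun h => h.isGradedPStarMD fun r ⟨α, hα⟩ => ⟨_, algebraMap_mem_component hα⟩⟩
  obtain ⟨b, -, hb0, hb⟩ := exists_common_denominator hfin.toFinset (by simpa using hS)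
  exact ⟨algebraMap R K b, (map_ne_zero_iff _ (IsFractionRing.injective R K)).2 hb0,
    by simpa using hb⟩

theorem isGradedPStarMD_overring_iff {s : SemistarOperation T K} :
    IsGradedPStarMD (overringComponent 𝒜 T) s ↔
      HomogeneousSpansInvertible (homogeneousQuotientFieldComponent 𝒜 K) s := by
  refine ⟨fun h => h.homogeneousSpansInvertible fun S hfin hS => ?_,
    fun h => h.isGradedPStarMD fun _ ha => ha⟩
  obtain ⟨b, -, hb0, hb⟩ := exists_common_denominator hfin.toFinset (by simpa using hS)
  refine ⟨algebraMap R K b, (map_ne_zero_iff _ (IsFractionRing.injective R K)).2 hb0,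
    fun x hx => ?_⟩
  obtain ⟨r, ⟨α, hα⟩, hr⟩ := hb x (hfin.mem_toFinset.2 hx)
  exact ⟨algebraMap R T r, ⟨_, algebraMap_mem_component hα⟩, hr⟩

end HomogeneousOverring

section Linked

open Algebra

variable {Γ R K : Type*} [AddCommMonoid Γ] [IsCancelAdd Γ] [DecidableEq Γ] [CommRing R]
  [IsDomain R] [Field K] [Algebra R K] [IsFractionRing R K] {𝒜 : Γ → AddSubgroup R} [GradedRing 𝒜]
  {s : SemistarOperation R K} {T : Subalgebra R K} {s' : SemistarOperation T K}

theorem IsGradedSubfield.IsHomogeneous.exists_finset {G K D : Type*} [AddCommGroup G] [Field K]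
    [CommRing D] [Algebra D K] {C : G → AddSubgroup K} {hC : IsGradedSubfield C}
    {B E : Submodule D K} (hE : hC.IsHomogeneous E) (hB : B.FG) (hBE : B ≤ E) :
    ∃ Y : Finset K, (∀ y ∈ Y, ∃ γ, y ∈ C γ) ∧ Submodule.span D Y ≤ E ∧
      B ≤ Submodule.span D Y := by
  classical
  obtain ⟨S, rfl⟩ := hB
  choose! p hpE hpx using fun x (hx : x ∈ S) => hE x (hBE (Submodule.subset_span hx))
  have hspan : Submodule.span D (S.biUnion fun x => (p x).1.coeff.finite_range.toFinset : Finset K)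
      = ⨆ x ∈ S, content D (p x).1 := by
    rw [Finset.coe_biUnion]
    simp_rw [Submodule.span_iUnion, Set.Finite.coe_toFinset]
    rfl
  refine ⟨S.biUnion fun x => (p x).1.coeff.finite_range.toFinset, fun y hy => ?_, ?_, ?_⟩
  · obtain ⟨x, -, hy⟩ := Finset.mem_biUnion.1 hy
    obtain ⟨γ, rfl⟩ := (Set.Finite.mem_toFinset _).1 hy
    exact ⟨γ, (p x).2 γ⟩
  · exact hspan ▸ iSup₂_le hpE
  · rw [hspan, Submodule.span_le]
    intro x hx
    rw [← hpx x hx]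
    exact le_iSup₂ (f := fun x (_ : x ∈ S) => content D (p x).1) x hx (hC.eval_mem_content _)

theorem exists_isHomogeneousIdeal_le {E : Submodule R K}
    (hE : (isGradedSubfield_component 𝒜 K).IsHomogeneous E) (hE1 : E ≤ 1)
    (hs : 1 ∈ s.finiteType E) :
    ∃ F : Ideal R, F ≠ ⊥ ∧ F.FG ∧ IsHomogeneousIdeal 𝒜 F ∧
      s (IsLocalization.coeSubmodule K F) = s 1 ∧ IsLocalization.coeSubmodule K F ≤ E := by
  obtain ⟨B, hB, hBE, hB1⟩ := hs
  obtain ⟨Y, hY, hYE, hBY⟩ := hE.exists_finset hB hBE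
  have hF : IsLocalization.coeSubmodule K (Ideal.span (algebraMap R K ⁻¹' Y)) =
      Submodule.span R Y := by
    rw [IsLocalization.coeSubmodule_span, Set.image_preimage_eq_of_subset]
    exact fun y hy => Submodule.mem_one.1 (hE1 (hYE (Submodule.subset_span hy)))
  have hs1 := s.monotone hBY hB1
  refine ⟨Ideal.span (algebraMap R K ⁻¹' Y), ?_, ?_, ?_, ?_, hF ▸ hYE⟩
  · intro hbot
    rw [← hF, hbot, IsLocalization.coeSubmodule_bot, s.map_bot, Submodule.mem_bot] at hs1
    exact one_ne_zero hs1
  · exact Submodule.fg_span (Y.finite_toSet.preimage (IsFractionRing.injective R K).injOn)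
  · exact isHomogeneousIdeal_span fun r hr =>
      isHomogeneousElem_of_algebraMap_mem (hY _ hr).choose_spec
  · rw [hF, SemistarOperation.apply_eq_apply_one_iff (hYE.trans hE1)]
    exact hs1

theorem coeSubmodule_map_le {R K : Type*} [CommRing R] [Field K] [Algebra R K]
    {T : Subalgebra R K} {F : Ideal R} {S : Set K}
    (h : IsLocalization.coeSubmodule K F ≤ Submodule.span R S * (1 / Submodule.span R S)) :
    IsLocalization.coeSubmodule K (F.map (algebraMap R T)) ≤
      Submodule.span T S * (1 / Submodule.span T S) := by
  rw [Ideal.map, IsLocalization.coeSubmodule_span, Submodule.span_le]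
  rintro _ ⟨_, ⟨f, hf, rfl⟩, rfl⟩
  rw [← IsScalarTower.algebraMap_apply, SetLike.mem_coe]
  have hf' := h ((IsLocalization.mem_coeSubmodule K F).2 ⟨f, hf, rfl⟩)
  generalize algebraMap R K f = x at hf' ⊢
  induction hf' using Submodule.mul_induction_on' with
  | mem_mul_mem y hy z hz =>
    refine Submodule.mul_mem_mul (Submodule.span_subset_span R T S hy) ?_
    rw [mem_one_div_span] at hz ⊢
    intro w hw
    obtain ⟨r, hr⟩ := Submodule.mem_one.1 (hz w hw)
    exact hr ▸ mem_one_subalgebra.2 (T.algebraMap_mem r)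
  | add y _ z _ hy hz => exact add_mem hy hz

theorem IsHomogeneouslyLinked.homogeneousSpansInvertible (hT : IsHomogeneouslyLinked 𝒜 s T s')
    (h : HomogeneousSpansInvertible (homogeneousQuotientFieldComponent 𝒜 K) s) :
    HomogeneousSpansInvertible (homogeneousQuotientFieldComponent 𝒜 K) s' := by
  intro S hfin hS hS0
  have hR := isHomogeneous_one (K := K) 𝒜
  obtain ⟨F, hF0, hFfg, hF, hFs, hFS⟩ := exists_isHomogeneousIdeal_le
    ((IsGradedSubfield.isHomogeneous_span hR hS).mul
      (IsGradedSubfield.isHomogeneous_one_div_span hR hS hS0))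
    Submodule.mul_one_div_le_one (isStarInvertible_iff.1 (h S hfin hS hS0))
  have hFT := SemistarOperation.apply_one_le_iff.1 (hT.linked F hF0 hFfg hF hFs).ge
  rw [isStarInvertible_iff]
  refine s'.finiteType.monotone (coeSubmodule_map_le hFS) ?_
  have hFTfg : (IsLocalization.coeSubmodule K (F.map (algebraMap R T))).FG :=
    Submodule.FG.map _ (Ideal.FG.map hFfg _)
  rwa [SemistarOperation.finiteType_apply_of_fg hFTfg]

theorem IsHomogeneousOverring.isPvMD [IsAddTorsionFree Γ] (hT : IsHomogeneousOverring 𝒜 T)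
    (hinv : HomogeneousSpansInvertible (homogeneousQuotientFieldComponent 𝒜 K)
      (SemistarOperation.v T K)) : IsPvMD T K :=
  have := isAddTorsionFree_grothendieckAddGroup Γ
  IsGradedSubfield.isPvMD (isHomogeneousOverring_iff.1 hT) hinv

end Linked

section Seidenberg

open Polynomial IsLocalization

variable {V K : Type*} [CommRing V] [IsLocalRing V] [IsIntegrallyClosed V] [Field K] [Algebra V K]
  [IsFractionRing V K] {x : K}

-- Multiplying by the leading coefficient makes `x` integral, which lowers the degree of the
-- relation.
theorem isInteger_or_isInteger_inv_of_aeval_eq_zero {p : V[X]} (hp : aeval x p = 0)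
    (hunit : ∃ i, IsUnit (p.coeff i)) : IsInteger V x ∨ IsInteger V x⁻¹ := by
  induction hn : p.natDegree using Nat.strong_induction_on generalizing p with
  | _ n ih =>
  obtain ⟨i, hi⟩ := hunit
  obtain ⟨y, hy⟩ := IsIntegrallyClosed.isIntegral_iff.1 (isIntegral_leadingCoeff_smul p x hp)
  rw [Algebra.smul_def] at hy
  have hin : i ≤ n := hn ▸ le_natDegree_of_ne_zero hi.ne_zero
  rcases hin.eq_or_lt with rfl | hin
  · obtain ⟨u, hu⟩ := hi
    refine Or.inl ⟨↑u⁻¹ * y, ?_⟩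
    rw [map_mul, hy, leadingCoeff, hn, ← hu, ← mul_assoc, ← map_mul, Units.inv_mul, map_one,
      one_mul]
  by_cases hyu : IsUnit y
  · obtain ⟨u, rfl⟩ := hyu
    refine Or.inr ⟨↑u⁻¹ * p.leadingCoeff, eq_inv_of_mul_eq_one_left ?_⟩
    rw [map_mul, mul_assoc, ← hy, ← map_mul, Units.inv_mul, map_one]
  have hn0 : n - 1 + 1 = n := by lia
  have hlead : aeval x p.eraseLead + algebraMap V K p.leadingCoeff * x ^ n = 0 := by
    rw [← hp, ← hn]
    conv_rhs => rw [← p.eraseLead_add_monomial_natDegree_leadingCoeff]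
    rw [map_add, aeval_monomial]
  refine ih (p.eraseLead + monomial (n - 1) y).natDegree ?_ ?_ ⟨i, ?_⟩ rfl
  · refine (natDegree_add_le_of_degree_le (hn ▸ p.eraseLead_natDegree_le)
      (natDegree_monomial_le _)).trans_lt (by lia)
  · rw [map_add, aeval_monomial, hy, ← hlead, mul_assoc, ← pow_succ', hn0]
  · rw [coeff_add, eraseLead_coeff_of_ne _ (hn ▸ hin.ne), coeff_monomial]
    split_ifs
    · have hsum : IsUnit (p.coeff i + y + -y) := by rwa [add_neg_cancel_right]
      exact (IsLocalRing.isUnit_or_isUnit_of_isUnit_add hsum).resolve_right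
        fun h => hyu ((IsUnit.neg_iff y).1 h)
    · simpa using hi

theorem isInteger_or_isInteger_inv_of_mem_adjoin_sq (hx : x ∈ Algebra.adjoin V {x ^ 2}) :
    IsInteger V x ∨ IsInteger V x⁻¹ := by
  rw [Algebra.adjoin_singleton_eq_range_aeval] at hx
  obtain ⟨g, hg⟩ := hx
  refine isInteger_or_isInteger_inv_of_aeval_eq_zero (p := expand V 2 g - X) ?_ ⟨1, ?_⟩
  · rw [map_sub, expand_aeval, aeval_X, sub_eq_zero]
    exact hg
  · rw [coeff_sub, coeff_expand two_pos, if_neg (by decide), coeff_X_one, zero_sub]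
    exact isUnit_one.neg

end Seidenberg

section Subalgebra

variable {R K : Type*} [CommRing R] [Field K] [Algebra R K]

theorem isInteger_subalgebra_iff {T : Subalgebra R K} {x : K} :
    IsLocalization.IsInteger T x ↔ x ∈ T :=
  ⟨fun ⟨y, hy⟩ => hy ▸ y.2, fun h => ⟨⟨x, h⟩, rfl⟩⟩

theorem mem_of_sq_mem {T : Subalgebra R K} [IsFractionRing T K] [IsIntegrallyClosed T] {x : K}
    (hx : x ^ 2 ∈ T) : x ∈ T := by
  have hint : IsIntegral T (x ^ 2) := isIntegral_algebraMap (x := (⟨x ^ 2, hx⟩ : T))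
  obtain ⟨y, hy⟩ := IsIntegrallyClosed.isIntegral_iff.1 (hint.of_pow two_pos)
  exact hy ▸ y.2

theorem adjoin_union_le_restrictScalars {V : Subalgebra R K} {S X : Set K} (hS : S ⊆ V) :
    Algebra.adjoin R (S ∪ X) ≤ (Algebra.adjoin V X).restrictScalars R :=
  Algebra.adjoin_le <| Set.union_subset
    (fun y hy => Subalgebra.algebraMap_mem _ (⟨y, hS hy⟩ : V)) Algebra.subset_adjoin

theorem mem_or_inv_mem_of_isIntegrallyClosed_adjoin [IsFractionRing R K]
    {V : Subalgebra R K} [IsLocalRing V] [IsIntegrallyClosed V] {S : Set K} (hS : S ⊆ V) {x : K}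
    [IsIntegrallyClosed (Algebra.adjoin R (S ∪ {x ^ 2}))] : x ∈ V ∨ x⁻¹ ∈ V := by
  have hx : x ∈ Algebra.adjoin R (S ∪ {x ^ 2}) :=
    mem_of_sq_mem (Algebra.subset_adjoin (Or.inr rfl))
  rw [← isInteger_subalgebra_iff, ← isInteger_subalgebra_iff]
  exact isInteger_or_isInteger_inv_of_mem_adjoin_sq (adjoin_union_le_restrictScalars hS hx)

end Subalgebra

section LocalizationAtPrime

variable {R K : Type*} [CommRing R] [IsDomain R] [Field K] [Algebra R K] [IsFractionRing R K]

variable (K) in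
/-- The localization `R_Q` at a prime ideal, as a subring of the quotient field `K`. -/
noncomputable abbrev localizationAtPrime (Q : Ideal R) [Q.IsPrime] : Subalgebra R K :=
  Localization.subalgebra.ofField K Q.primeCompl Q.primeCompl_le_nonZeroDivisors

variable {Q : Ideal R} [Q.IsPrime]

theorem inv_mem_localizationAtPrime {r : R} (hr : r ∉ Q) :
    (algebraMap R K r)⁻¹ ∈ localizationAtPrime K Q :=
  ⟨1, r, hr, by rw [map_one, one_mul]⟩

theorem mem_localizationAtPrime_of_mul_mem {r : R} (hr : r ∉ Q) {x : K}
    (h : algebraMap R K r * x ∈ localizationAtPrime K Q) : x ∈ localizationAtPrime K Q := by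
  have hr0 : algebraMap R K r ≠ 0 := (map_ne_zero_iff _ (IsFractionRing.injective R K)).2
    fun h0 => hr (h0 ▸ Q.zero_mem)
  simpa [hr0] using mul_mem (inv_mem_localizationAtPrime (K := K) hr) h

theorem isIntegrallyClosed_localizationAtPrime {S : Subalgebra R K} [IsIntegrallyClosed S]
    (hS : S ≤ localizationAtPrime K Q) : IsIntegrallyClosed (localizationAtPrime K Q) := by
  rw [isIntegrallyClosed_iff K]
  intro x hx
  obtain ⟨⟨m, hm⟩, hmx⟩ := hx.exists_multiple_integral_of_isLocalization Q.primeCompl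
  have hmx' : IsIntegral R (algebraMap R K m * x) := Algebra.smul_def m x ▸ hmx
  obtain ⟨y, hy⟩ := IsIntegrallyClosed.isIntegral_iff.1 (hmx'.tower_top (A := S))
  exact ⟨⟨x, mem_localizationAtPrime_of_mul_mem hm (hy ▸ hS y.2)⟩, rfl⟩

theorem exists_notMem_algebraMap_mem_span_mul_one_div {S : Set K} (hfin : S.Finite) {a : K}
    (haS : a ∈ S) (ha : a ≠ 0) (hS : ∀ b ∈ S, b / a ∈ localizationAtPrime K Q) :
    ∃ m ∉ Q, algebraMap R K m ∈ Submodule.span R S * (1 / Submodule.span R S) := by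
  classical
  choose! v hv using fun b (hb : b ∈ S) => (⟨⟨_, hS b hb⟩, rfl⟩ :
    ∃ v : localizationAtPrime K Q, (v : K) = b / a)
  obtain ⟨⟨m, hm⟩, hmv⟩ := IsLocalization.exist_integer_multiples_of_finset Q.primeCompl
    (hfin.toFinset.image v)
  refine ⟨m, hm, ?_⟩
  rw [← mul_div_cancel₀ (algebraMap R K m) ha]
  refine Submodule.mul_mem_mul (Submodule.subset_span haS) (mem_one_div_span.2 fun b hb => ?_)
  obtain ⟨r, hr⟩ := hmv (v b) (Finset.mem_image_of_mem v (hfin.mem_toFinset.2 hb))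
  refine Submodule.mem_one.2 ⟨r, ?_⟩
  have := congrArg Subtype.val hr
  rw [div_mul_eq_mul_div, mul_div_assoc, ← hv b hb, ← Algebra.smul_def]
  exact this

theorem exists_mem_forall_div_mem {K : Type*} [Field K] (V : Subring K) {S : Set K}
    (hfin : S.Finite) (hS0 : ∃ x ∈ S, x ≠ 0)
    (hV : ∀ x ∈ S, ∀ y ∈ S, x / y ∈ V ∨ y / x ∈ V) :
    ∃ a ∈ S, a ≠ 0 ∧ ∀ b ∈ S, b / a ∈ V := by
  obtain ⟨a, ⟨haS, ha⟩, hmax⟩ := (hfin.inter_of_left {x | x ≠ 0}).exists_maximalFor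
    (fun x => Submodule.span V {x}) _ hS0
  refine ⟨a, haS, ha, fun b hb => ?_⟩
  rcases eq_or_ne b 0 with rfl | hb0
  · rw [zero_div]
    exact zero_mem V
  refine (hV a haS b hb).elim (fun hab => ?_) id
  have hle : Submodule.span V {a} ≤ Submodule.span V {b} :=
    (Submodule.span_singleton_le_iff_mem _ _).2
      (Submodule.mem_span_singleton.2 ⟨⟨a / b, hab⟩, div_mul_cancel₀ a hb0⟩)
  obtain ⟨c, hc⟩ := Submodule.mem_span_singleton.1
    (hmax ⟨hb, hb0⟩ hle (Submodule.mem_span_singleton_self b))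
  rw [← hc]
  have : c • a / a = c := mul_div_cancel_right₀ (c : K) ha
  exact this ▸ c.2

variable {Γ : Type*} {𝒜 : Γ → AddSubgroup R}

variable (K 𝒜) in
/-- The inverses of the homogeneous elements outside `Q`. Adjoining them to `R` yields the
homogeneous localization at `Q`. -/
def homogeneousInverses (Q : Ideal R) : Set K :=
  {x | ∃ h, SetLike.IsHomogeneousElem 𝒜 h ∧ h ∉ Q ∧ x = (algebraMap R K h)⁻¹}

theorem homogeneousInverses_subset : homogeneousInverses K 𝒜 Q ⊆ localizationAtPrime K Q := by
  rintro _ ⟨h, -, hhQ, rfl⟩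
  exact inv_mem_localizationAtPrime hhQ

end LocalizationAtPrime

section IntegrallyClosedOverrings

open SemistarOperation

variable {Γ R K : Type*} [AddCommMonoid Γ] [IsCancelAdd Γ] [DecidableEq Γ] [CommRing R]
  [IsDomain R] [Field K] [Algebra R K] [IsFractionRing R K] {𝒜 : Γ → AddSubgroup R} [GradedRing 𝒜]
  {s : SemistarOperation R K}

theorem IsHomogeneouslyLinked.of_d {T : Subalgebra R K} (hT : IsHomogeneouslyLinked 𝒜 s T (d T K))
    (s' : SemistarOperation T K) : IsHomogeneouslyLinked 𝒜 s T s' :=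
  ⟨hT.isHomogeneousOverring, fun F hF0 hFfg hF hFs => congrArg s' (hT.linked F hF0 hFfg hF hFs)⟩

theorem isHomogeneouslyLinked_adjoin {Q : Ideal R}
    (hQ : 1 ∉ s.finiteType (IsLocalization.coeSubmodule K Q)) {X : Set K}
    (hX : ∀ x ∈ X, ∃ γ, x ∈ homogeneousQuotientFieldComponent 𝒜 K γ) :
    IsHomogeneouslyLinked 𝒜 s (Algebra.adjoin R (homogeneousInverses K 𝒜 Q ∪ X)) (d _ K) := by
  set T := Algebra.adjoin R (homogeneousInverses K 𝒜 Q ∪ X)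
  refine ⟨isHomogeneousOverring_adjoin ?_, fun F hF0 hFfg hF hFs => ?_⟩
  · rintro x (⟨h, ⟨α, hα⟩, -, rfl⟩ | hx)
    · exact ⟨_, (isGradedSubfield_component 𝒜 K).inv_mem_neg (algebraMap_mem_component hα)⟩
    · exact hX x hx
  obtain ⟨h, ⟨hhF, hh⟩, hhQ⟩ : ∃ h ∈ {x | x ∈ F ∧ SetLike.IsHomogeneousElem 𝒜 x}, h ∉ Q := by
    by_contra! hle
    rw [← SetLike.mem_coe] at hQ
    refine hQ (s.finiteType.monotone (IsLocalization.coeSubmodule_mono K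
      (hF.span_eq ▸ Ideal.span_le.2 hle)) ?_)
    have hFfg' : (IsLocalization.coeSubmodule K F).FG := Submodule.FG.map _ hFfg
    rw [finiteType_apply_of_fg hFfg', hFs]
    exact apply_one_le_iff.1 le_rfl
  have hh0 : algebraMap R K h ≠ 0 := (map_ne_zero_iff _ (IsFractionRing.injective R K)).2
    fun h0 => hhQ (h0 ▸ Q.zero_mem)
  have hinv : (algebraMap R K h)⁻¹ ∈ T := Algebra.subset_adjoin (Or.inl ⟨h, hh, hhQ, rfl⟩)
  have hFT : F.map (algebraMap R T) = ⊤ := by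
    refine Ideal.eq_top_of_isUnit_mem _ (Ideal.mem_map_of_mem _ hhF) (.of_mul_eq_one ⟨_, hinv⟩ ?_)
    exact Subtype.ext (mul_inv_cancel₀ hh0)
  rw [hFT, IsLocalization.coeSubmodule_top]

theorem mem_or_inv_mem_localizationAtPrime {Q : Ideal R} [Q.IsPrime]
    (hint : ∀ T : Subalgebra R K, IsHomogeneouslyLinked 𝒜 s T (d T K) → IsIntegrallyClosed T)
    (hQ : 1 ∉ s.finiteType (IsLocalization.coeSubmodule K Q)) {x : K}
    {γ : Algebra.GrothendieckAddGroup Γ} (hx : x ∈ homogeneousQuotientFieldComponent 𝒜 K γ) :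
    x ∈ localizationAtPrime K Q ∨ x⁻¹ ∈ localizationAtPrime K Q := by
  have := IsLocalization.AtPrime.isLocalRing (localizationAtPrime K Q) Q
  have := hint _ (isHomogeneouslyLinked_adjoin hQ (X := ∅) (by simp))
  have : IsIntegrallyClosed (localizationAtPrime K Q) := isIntegrallyClosed_localizationAtPrime <|
    Algebra.adjoin_le (Set.union_subset (homogeneousInverses_subset (𝒜 := 𝒜)) (Set.empty_subset _))
  have := hint _ (isHomogeneouslyLinked_adjoin hQ (X := {x ^ 2}) (by
    rintro _ rfl
    exact ⟨γ + γ, sq x ▸ (isGradedSubfield_component 𝒜 K).mul_mem_add hx hx⟩))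
  exact mem_or_inv_mem_of_isIntegrallyClosed_adjoin (homogeneousInverses_subset (𝒜 := 𝒜))

theorem homogeneousSpansInvertible_of_isIntegrallyClosed
    (hint : ∀ T : Subalgebra R K, IsHomogeneouslyLinked 𝒜 s T (d T K) → IsIntegrallyClosed T) :
    HomogeneousSpansInvertible (homogeneousQuotientFieldComponent 𝒜 K) s := by
  intro S hfin hS hS0
  rw [isStarInvertible_iff]
  by_contra h1
  have hI : IsLocalization.coeSubmodule K (Submodule.comap (Algebra.linearMap R K)
      (Submodule.span R S * (1 / Submodule.span R S))) =
        Submodule.span R S * (1 / Submodule.span R S) :=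
    Submodule.map_comap_eq_self (Submodule.mul_one_div_le_one.trans Submodule.one_eq_range.le)
  obtain ⟨Q, hQprime, hIQ, hQ⟩ := exists_prime_of_one_notMem_finiteType (hI.symm ▸ h1)
  have hC := isGradedSubfield_component 𝒜 K
  obtain ⟨a, haS, ha, hdiv⟩ := exists_mem_forall_div_mem (localizationAtPrime K Q).toSubring hfin
    hS0 fun x hx y hy => by
      obtain ⟨γ, hγ⟩ := hS x hx
      obtain ⟨δ, hδ⟩ := hS y hy
      have := mem_or_inv_mem_localizationAtPrime hint hQ
        (hC.mul_mem_add hγ (hC.inv_mem_neg hδ))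
      rwa [← div_eq_mul_inv, inv_div] at this
  obtain ⟨m, hmQ, hm⟩ := exists_notMem_algebraMap_mem_span_mul_one_div hfin haS ha hdiv
  exact hmQ (hIQ hm)

end IntegrallyClosedOverrings

theorem theorem4p7_general {Γ R K : Type*} [AddCommMonoid Γ] [IsCancelAdd Γ] [IsAddTorsionFree Γ]
    [DecidableEq Γ] [CommRing R] [IsDomain R] [Field K] [Algebra R K] [IsFractionRing R K]
    (𝒜 : Γ → AddSubgroup R) [GradedRing 𝒜] (s : SemistarOperation R K) :
    List.TFAE [
      IsGradedPStarMD 𝒜 s,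
      ∀ T : Subalgebra R K, IsHomogeneouslyLinked 𝒜 s T (SemistarOperation.t T K) → IsPvMD T K,
      ∀ T : Subalgebra R K, IsHomogeneouslyLinked 𝒜 s T (SemistarOperation.d T K) →
        IsGradedPrufer K (overringComponent 𝒜 T),
      ∀ T : Subalgebra R K, IsHomogeneouslyLinked 𝒜 s T (SemistarOperation.t T K) →
        IsIntegrallyClosed T,
      ∀ T : Subalgebra R K, IsHomogeneouslyLinked 𝒜 s T (SemistarOperation.d T K) →
        IsIntegrallyClosed T] := by
  tfae_have 1 → 2 := fun h T hT => hT.isHomogeneousOverring.isPvMD <|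
    .mono (SemistarOperation.finiteType_le_apply _)
      (hT.homogeneousSpansInvertible (isGradedPStarMD_iff.1 h))
  tfae_have 1 → 3 := fun h T hT => isGradedPStarMD_overring_iff.2 <|
    hT.homogeneousSpansInvertible (isGradedPStarMD_iff.1 h)
  tfae_have 2 → 4 := fun h T hT => (h T hT).isIntegrallyClosed
  tfae_have 3 → 5 := fun h T hT => (hT.isHomogeneousOverring.isPvMD <|
    .mono (SemistarOperation.le_self _)
      (isGradedPStarMD_overring_iff.1 (h T hT))).isIntegrallyClosed
  tfae_have 4 → 5 := fun h T hT => h T (hT.of_d _)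
  tfae_have 5 → 1 := fun h =>
    isGradedPStarMD_iff.2 (homogeneousSpansInvertible_of_isIntegrallyClosed h)
  tfae_finish

theorem theorem4p7 {Γ R K : Type*} [AddCommMonoid Γ] [IsCancelAdd Γ] [IsAddTorsionFree Γ]
    [DecidableEq Γ] [CommRing R] [IsDomain R] [Field K] [Algebra R K] [IsFractionRing R K]
    (𝒜 : Γ → AddSubgroup R) [GradedRing 𝒜]
    (hunit : ∃ α : Γ, α ≠ 0 ∧ ∃ u ∈ 𝒜 α, IsUnit u)
    (s : SemistarOperation R K)
    (hs : s 1 < Subalgebra.toSubmodule (homogeneousQuotientField 𝒜 K)) :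
    List.TFAE [
      IsGradedPStarMD 𝒜 s,
      ∀ T : Subalgebra R K, IsHomogeneouslyLinked 𝒜 s T (SemistarOperation.t T K) → IsPvMD T K,
      ∀ T : Subalgebra R K, IsHomogeneouslyLinked 𝒜 s T (SemistarOperation.d T K) →
        IsGradedPrufer K (overringComponent 𝒜 T),
      ∀ T : Subalgebra R K, IsHomogeneouslyLinked 𝒜 s T (SemistarOperation.t T K) →
        IsIntegrallyClosed T,
      ∀ T : Subalgebra R K, IsHomogeneouslyLinked 𝒜 s T (SemistarOperation.d T K) →
        IsIntegrallyClosed T] :=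
  theorem4p7_general 𝒜 s
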